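/- **Setting.** Let $T\in\mathbb N$, $d\ge 2$, and let $\Omega_1$ be a Polish space. For $0\le t\le T$ let $\Omega_t$ be the $(t+1)$-fold product of $\Omega_1$, with elements $(\omega_0,\dots,\omega_t)$, let $\mathcal F_t$ be its Borel $\sigma$-algebra and $\mathcal F^u_t$ the universal completion of $\mathcal F_t$; functions on $\Omega_t$ are also regarded as functions on $\Omega_T$. Let $\mathfrak P(\Omega_1)$ be the set of Borel probability measures on $\Omega_1$, with the weak topology. Let $\mathcal R_0\subset\mathfrak P(\Omega_1)$ be any set (the possible laws of $\omega_0$) and, for $0\le t<T$ and $\omega\in\Omega_t$, let $\mathcal P_t(\omega)\subset\mathfrak P(\Omega_1)$ be non-empty and such that the graph $\{(\omega,P):P\in\mathcal P_t(\omega)\}$ is an analytic subset of $\Omega_t\times\mathfrak P(\Omega_1)$. Let $\mathcal P$ be the set of all laws $\mu\otimes P_0\otimes\cdots\otimes P_{T-1}$ on $\Omega_T$, where $\mu\in\mathcal R_0$ and each $P_t$ is an $\mathcal F^u_t$-measurable selector of $\mathcal P_t$, used as the conditional law of $\omega_{t+1}$ given $(\omega_0,\dots,\omega_t)$. A property holds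 $\mathcal P$-quasi-surely (q.s.) if it holds $P$-a.s. for every $P\in\mathcal P$; for a set of measures on $\Omega_1$ the meaning is the same. For $0\le t\le T$ let $K_t(\omega)$ and $C_t(\omega)$, $\omega\in\Omega_t$, be closed convex cones in $\mathbb R^d$ with $\mathbb R^d_+\subset K_t$, both Borel measurable as multifunctions, i.e. $\{\omega: K_t(\omega)\cap O\ne\emptyset\}\in\mathcal F_t$ for every open $O\subset\mathbb R^d$, and likewise for $C_t$. The dual of a set $A\subset\mathbb R^d$ is $A^*=\{x: x\cdot a\ge 0\ \forall a\in A\}$. *Efficient friction assumption:* $\operatorname{int}(K_t^*(\omega))\neq\emptyset$ for all $t\le T$ and $\omega\in\Omega_t$, and $C_t\subset C_{t+1}$ for all $t<T$. *No Strict Arbitrage.* For a family of random cones $\mathbb L=(L_t)_{t\le T}$ let $A_t(\mathbb L)$ be the set of all $\mathcal F^u_t$-measurable selectors $\xi$ of $C_t$ of the form $\xi=\sum_{s=0}^t -k_s$ q.s., where each $k_s$ is $\mathcal F^u_s$-measurable with $k_s\in L_s$ q.s. Then $\mathrm{NA}^s$ holds for $\mathbb L$ if, for every $t\le T$, every $\xi\in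 A_t(\mathbb L)$ which is a selector of $L_t$ satisfies $\xi=0$ $\mathcal P$-q.s. *Backward recursion.* Let $\tilde K^*_T:=K^*_T$ and, for $t=T-1,\dots,0$ and $\omega\in\Omega_t$, $$\tilde K^*_t(\omega):=K^*_t(\omega)\cap\Big(\overline{\operatorname{conv}}\,(\Gamma_t(\omega))+C^*_t(\omega)\Big),$$ where $\Gamma_t(\omega)$ is the $\mathcal P_t(\omega)$-quasi-sure support of $\tilde K^*_{t+1}(\omega;\cdot)$, i.e. the smallest closed set $F\subset\mathbb R^d$ with $\tilde K^*_{t+1}(\omega;\cdot)\subset F$ $\mathcal P_t(\omega)$-q.s. Let $\tilde K_t:=(\tilde K^*_t)^*$ and $\tilde{\mathbb K}:=(\tilde K_t)_{t\le T}$. **Proposition.** Suppose that $\mathbb K=(K_t)_{t\le T}$ satisfies the efficient friction assumption and $\mathrm{NA}^s$. Then $\operatorname{int}(\tilde K^*_t)\neq\emptyset$ $\mathcal P$-quasi-surely for every $t\le T$ (the efficient friction property for $\tilde{\mathbb K}$ in its quasi-sure form), and $\tilde{\mathbb K}$ satisfies $\mathrm{NA}^s$. -/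

import Mathlib

open MeasureTheory Set
open scoped Pointwise

noncomputable section

/-- The space of the `d`-dimensional positions. -/
abbrev Pos (d : ℕ) : Type := EuclideanSpace ℝ (Fin d)

/-- `Ω_t`, the `(t+1)`-fold product of the space `X = Ω₁`: paths `(ω_0, …, ω_t)`. -/
abbrev Traj (X : Type*) (t : ℕ) : Type _ := Fin (t + 1) → X

/-- `(ω_0, …, ω_t)` followed by `x`. -/
def Traj.extend {X : Type*} {t : ℕ} (ω : Traj X t) (x : X) : Traj X (t + 1) :=
  Fin.snoc (α := fun _ => X) ω x

/-- For `s ≤ t`, the initial part `(ω_0, …, ω_s)` of `ω = (ω_0, …, ω_t)`.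
(For `s > t`, which is never used, the last coordinate is repeated.) -/
def Traj.upTo {X : Type*} {t : ℕ} (s : ℕ) (ω : Traj X t) : Traj X s :=
  fun i => ω ⟨min (i : ℕ) t, Nat.lt_succ_of_le (Nat.min_le_right _ _)⟩

/-- The universal completion of a sigma-algebra: the sets that belong to the completion with
respect to every probability measure. -/
@[reducible] def universalCompletion (Y : Type*) [MeasurableSpace Y] : MeasurableSpace Y where
  MeasurableSet' s := ∀ P : ProbabilityMeasure Y, NullMeasurableSet s (P : Measure Y)
  measurableSet_empty _ := .empty
  measurableSet_compl _ hs P := (hs P).compl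
  measurableSet_iUnion _ hf P := .iUnion fun i => hf i P

/-- Universally measurable maps. -/
def UnivMeasurable {Y Z : Type*} [MeasurableSpace Y] [MeasurableSpace Z] (f : Y → Z) : Prop :=
  Measurable[universalCompletion Y] f

/-- `p` holds quasi-surely with respect to a class of priors. -/
def QuasiSurely {Y : Type*} [MeasurableSpace Y] (R : Set (ProbabilityMeasure Y))
    (p : Y → Prop) : Prop :=
  ∀ P ∈ R, ∀ᵐ y ∂(P : Measure Y), p y

/-- The quasi-sure support of a multifunction `U`: the smallest closed set `F` such that
`U ⊆ F` quasi-surely (see `quasiSurely_subset_qsSupport`). -/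
def qsSupport {Y Z : Type*} [MeasurableSpace Y] [TopologicalSpace Z]
    (R : Set (ProbabilityMeasure Y)) (U : Y → Set Z) : Set Z :=
  ⋂₀ {F | IsClosed F ∧ QuasiSurely R fun y => U y ⊆ F}

theorem quasiSurely_subset_qsSupport {Y Z : Type*} [MeasurableSpace Y] [TopologicalSpace Z]
    [SecondCountableTopology Z] (R : Set (ProbabilityMeasure Y)) (U : Y → Set Z) :
    QuasiSurely R fun y => U y ⊆ qsSupport R U := by
  intro P hP
  obtain ⟨S, hSc, hS, hSu⟩ := TopologicalSpace.isOpen_sUnion_countable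
    (compl '' {F : Set Z | IsClosed F ∧ QuasiSurely R fun y => U y ⊆ F}) (by
      rintro _ ⟨F, hF, rfl⟩
      exact hF.1.isOpen_compl)
  have h1 : ∀ᵐ y ∂(P : Measure Y), ∀ O ∈ S, U y ⊆ Oᶜ := by
    rw [ae_ball_iff hSc]
    intro O hO
    obtain ⟨F, hF, rfl⟩ := hS hO
    simpa using hF.2 P hP
  filter_upwards [h1] with y hy z hz
  by_contra hzF
  have hz2 : z ∈ ⋃₀ S := by
    rw [hSu, ← compl_sInter]
    exact hzF
  obtain ⟨O, hO, hzO⟩ := hz2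
  exact hy O hO hz hzO

/-- A multifunction is measurable if the sets `{U ∩ O ≠ ∅}`, `O` open, are measurable. -/
def MeasurableMultifunction {Y Z : Type*} [MeasurableSpace Y] [TopologicalSpace Z]
    (U : Y → Set Z) : Prop :=
  ∀ O : Set Z, IsOpen O → MeasurableSet {y | (U y ∩ O).Nonempty}

/-- A family of random closed convex cones `K_t(ω)`, `ω ∈ Ω_t` (only the times `t ≤ T` matter). -/
abbrev ConeFamily (X : Type*) (d : ℕ) : Type _ := (t : ℕ) → Traj X t → ProperCone ℝ (Pos d)

section Model

variable {X : Type*} [MeasurableSpace X]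

/-- The law `μ ⊗ κ_0 ⊗ ⋯ ⊗ κ_{t-1}` on `Ω_t`, where `μ` is the law of `ω_0` and
`κ_s(ω_0, …, ω_s)` is the conditional law of `ω_{s+1}`. -/
def pathLaw (μ : ProbabilityMeasure X) (κ : (t : ℕ) → Traj X t → ProbabilityMeasure X) :
    (t : ℕ) → Measure (Traj X t)
  | 0 => (μ : Measure X).map fun x _ => x
  | t + 1 => (pathLaw μ κ t).bind fun ω => (κ t ω : Measure X).map ω.extend

/-- The class `𝓟` of priors on `Ω_T`: the laws `μ ⊗ P_0 ⊗ ⋯ ⊗ P_{T-1}`, where `μ` belongs to the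
class `R₀` of initial laws and `P_t` is a universally measurable selector of `R_t`. -/
def priors (T : ℕ) (R₀ : Set (ProbabilityMeasure X))
    (R : (t : ℕ) → Traj X t → Set (ProbabilityMeasure X)) : Set (ProbabilityMeasure (Traj X T)) :=
  {P | ∃ μ ∈ R₀, ∃ κ : (t : ℕ) → Traj X t → ProbabilityMeasure X,
    (∀ t < T, UnivMeasurable (κ t) ∧ ∀ ω, κ t ω ∈ R t ω) ∧
      (P : Measure (Traj X T)) = pathLaw μ κ T}

/-- The set `A_t`: universally measurable selectors of `C_t` that are, quasi-surely, of the form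
`∑_{s ≤ t} -k_s` with `k_s` universally measurable on `Ω_s` and `k_s ∈ K_s` quasi-surely. -/
def attainable {d T : ℕ} (Pr : Set (ProbabilityMeasure (Traj X T))) (K C : ConeFamily X d) (t : ℕ) :
    Set (Traj X t → Pos d) :=
  {ξ | UnivMeasurable ξ ∧ (∀ ω, ξ ω ∈ C t ω) ∧
    ∃ k : (s : ℕ) → Traj X s → Pos d,
      (∀ s ≤ t, UnivMeasurable (k s) ∧
        QuasiSurely Pr fun ω => k s (ω.upTo s) ∈ K s (ω.upTo s)) ∧
      QuasiSurely Pr fun ω => ξ (ω.upTo t) = ∑ s ∈ Finset.range (t + 1), -k s (ω.upTo s)}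

/-- No Strict Arbitrage: for every `t ≤ T`, the only element of `A_t` that is a selector of `K_t`
is `0`, up to quasi-sure equality. -/
def NoStrictArbitrage {d T : ℕ} (Pr : Set (ProbabilityMeasure (Traj X T)))
    (K C : ConeFamily X d) : Prop :=
  ∀ t ≤ T, ∀ ξ ∈ attainable Pr K C t, (∀ ω, ξ ω ∈ K t ω) →
    QuasiSurely Pr fun ω => ξ (ω.upTo t) = 0

/-- The backward recursion for the cones `K̃*_t`: `K̃*_T = K*_T` and, for `t < T`,
`K̃*_t = K*_t ∩ (closure (conv Γ_t) + C*_t)`, with `Γ_t(ω)` the quasi-sure support of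
`K̃*_{t+1}(ω; ·)` with respect to `R_t(ω)`. -/
def tildeDual {d : ℕ} (T : ℕ) (R : (t : ℕ) → Traj X t → Set (ProbabilityMeasure X))
    (K C : ConeFamily X d) (t : ℕ) (ω : Traj X t) : Set (Pos d) :=
  if t < T then
    (ProperCone.innerDual (K t ω : Set (Pos d)) : Set (Pos d)) ∩
      (closure (convexHull ℝ
          (qsSupport (R t ω) fun x => tildeDual T R K C (t + 1) (ω.extend x))) +
        (ProperCone.innerDual (C t ω : Set (Pos d)) : Set (Pos d)))
  else ProperCone.innerDual (K t ω : Set (Pos d))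
termination_by T - t

theorem tildeDual_last {d : ℕ} (T : ℕ) (R : (t : ℕ) → Traj X t → Set (ProbabilityMeasure X))
    (K C : ConeFamily X d) (ω : Traj X T) :
    tildeDual T R K C T ω = ProperCone.innerDual (K T ω : Set (Pos d)) := by
  rw [tildeDual, if_neg (lt_irrefl T)]

theorem tildeDual_of_lt {d : ℕ} {T t : ℕ} (h : t < T)
    (R : (t : ℕ) → Traj X t → Set (ProbabilityMeasure X)) (K C : ConeFamily X d) (ω : Traj X t) :
    tildeDual T R K C t ω =
      (ProperCone.innerDual (K t ω : Set (Pos d)) : Set (Pos d)) ∩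
        (closure (convexHull ℝ
            (qsSupport (R t ω) fun x => tildeDual T R K C (t + 1) (ω.extend x))) +
          (ProperCone.innerDual (C t ω : Set (Pos d)) : Set (Pos d))) := by
  rw [tildeDual, if_pos h]

/-- The cones `K̃_t`, the duals of the `K̃*_t`. -/
def tildeCone {d : ℕ} (T : ℕ) (R : (t : ℕ) → Traj X t → Set (ProbabilityMeasure X))
    (K C : ConeFamily X d) : ConeFamily X d :=
  fun t ω => ProperCone.innerDual (tildeDual T R K C t ω)

end Model

theorem countablyGenerated_probabilityMeasure {X : Type*} [MeasurableSpace X]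
    [MeasurableSpace.CountablyGenerated X] :
    MeasurableSpace.CountablyGenerated (ProbabilityMeasure X) := by
  obtain ⟨b, hbc, hb⟩ := MeasurableSpace.CountablyGenerated.isCountablyGenerated (α := X)
  set S := generateSetAlgebra b with hS
  have hSc : Countable S := (countable_generateSetAlgebra hbc).to_subtype
  have hgen : ‹MeasurableSpace X› = MeasurableSpace.generateFrom S := by
    rw [hS, generateFrom_generateSetAlgebra_eq, hb]
  have hpi : IsPiSystem S := fun s hs t ht _ => isSetAlgebra_generateSetAlgebra.inter_mem hs ht
  let g : ProbabilityMeasure X → S → ENNReal := fun P s => (P : Measure X) s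
  have hg : Measurable g := measurable_pi_iff.2 fun s =>
    (Measure.measurable_coe (by
      rw [hgen]; exact MeasurableSpace.measurableSet_generateFrom s.2)).comp measurable_subtype_coe
  have h1 : (inferInstance : MeasurableSpace (ProbabilityMeasure X)) =
      MeasurableSpace.comap g inferInstance := by
    refine le_antisymm ?_ hg.comap_le
    have h2 : @Measurable _ _ (MeasurableSpace.comap g inferInstance) _
        (fun P : ProbabilityMeasure X => (P : Measure X)) := by
      refine @Measurable.measure_of_isPiSystem_of_isProbabilityMeasure _ _
        (MeasurableSpace.comap g inferInstance) _ _ _ S hgen hpi fun s hs => ?_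
      exact (measurable_pi_apply (⟨s, hs⟩ : S)).comp (comap_measurable g)
    exact h2.comap_le
  have h3 := MeasurableSpace.CountablyGenerated.comap g
  rw [← h1] at h3
  exact h3

/-- The map integrated in `pathLaw` is a.e.-measurable, so that `bind` is the usual integral. -/
theorem aemeasurable_kernel {X : Type*} [MeasurableSpace X]
    [MeasurableSpace.CountablyGenerated X] {t : ℕ} {κ : Traj X t → ProbabilityMeasure X}
    (hκ : UnivMeasurable κ) (ν : Measure (Traj X t)) [IsProbabilityMeasure ν] :
    AEMeasurable (fun ω => (κ ω : Measure X).map ω.extend) ν := by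
  have := countablyGenerated_probabilityMeasure (X := X)
  have h1 : AEMeasurable κ ν := by
    apply NullMeasurable.aemeasurable
    intro s hs
    exact hκ hs ⟨ν, inferInstance⟩
  have hext : Measurable fun p : Traj X t × X => p.1.extend p.2 := by
    rw [measurable_pi_iff]
    intro i
    refine Fin.lastCases ?_ (fun j => ?_) i
    · simpa [Traj.extend] using measurable_snd
    · simp only [Traj.extend, Fin.snoc_castSucc]
      fun_prop
  let F : Traj X t × ProbabilityMeasure X → Measure (Traj X (t+1)) :=
    fun p => (p.2 : Measure X).map p.1.extend
  have hF : Measurable F := by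
    refine Measure.measurable_of_measurable_coe _ fun s hs => ?_
    have : ∀ p : Traj X t × ProbabilityMeasure X, F p s = ((Measure.dirac p.1).prod (p.2 : Measure X))
        ((fun p : Traj X t × X => p.1.extend p.2) ⁻¹' s) := by
      intro p
      rw [Measure.dirac_prod, Measure.map_apply measurable_prodMk_left (hext hs),
        ← Set.preimage_comp]
      exact Measure.map_apply (hext.comp measurable_prodMk_left) hs
    simp_rw [this]
    have h2 := ProbabilityMeasure.measurable_fun_prod (α := Traj X t) (β := X)
    have h3 : Measurable fun p : Traj X t × ProbabilityMeasure X =>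
      ((⟨Measure.dirac p.1, inferInstance⟩ : ProbabilityMeasure (Traj X t)), p.2) :=
      ((Measure.measurable_dirac.comp measurable_fst).subtype_mk).prodMk measurable_snd
    exact (Measure.measurable_coe (hext hs)).comp (h2.comp h3)
  exact hF.comp_aemeasurable (aemeasurable_id.prodMk h1)

/-- `pathLaw` is a probability measure for universally measurable kernels. -/
theorem isProbabilityMeasure_pathLaw {X : Type*} [MeasurableSpace X]
    [MeasurableSpace.CountablyGenerated X] (μ : ProbabilityMeasure X)
    (κ : (t : ℕ) → Traj X t → ProbabilityMeasure X) (T : ℕ)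
    (hκ : ∀ t < T, UnivMeasurable (κ t)) : IsProbabilityMeasure (pathLaw μ κ T) := by
  induction T with
  | zero =>
    exact Measure.isProbabilityMeasure_map (by fun_prop)
  | succ t ih =>
    have := ih fun s hs => hκ s (by omega)
    constructor
    rw [pathLaw, Measure.bind_apply .univ (aemeasurable_kernel (hκ t (by omega)) _)]
    have : ∀ ω : Traj X t, ((κ t ω : Measure X).map ω.extend) univ = 1 := by
      intro ω
      have : Measurable ω.extend := by
        rw [measurable_pi_iff]
        intro i
        refine Fin.lastCases ?_ (fun j => ?_) i
        · simp only [Traj.extend, Fin.snoc_last]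
          fun_prop
        · simp [Traj.extend]
      rw [Measure.map_apply this .univ]; simp
    simp [this]

end

/-! Write `Γ` for the support at time `t` and `M = C_t ∩ Γ*` (`carryCone`): the positions that may
be held at time `t` and are q.s. solvent for `K̃_{t+1}`. The bipolar theorem says that `K̃_t*`
should be the dual of `K_t + M`, so that a `K̃_t`-solvent position splits into a trade in `K_t` and
a position in `M` carried to the next date. Since `closure (conv Γ) + C_t*` need not be closed, this
holds only up to closure; it is enough, because a convex set contains the interior of its closure
when that interior is nonempty. `dual_recursion` carries this out provided that `K_t` and `M` are
pointed and `K_t ∩ -M = {0}`: then `K_t + M` is closed and pointed, so its dual has interior.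

These conditions come from no arbitrage one date later. `NoStrictArbitrageAt` is the mixed condition
with trades in `K_s` for `s < t` and the cone `K̃_t` at time `t`. A selector violating pointedness
of `M` or `K_t ∩ -M = {0}` would be an arbitrage in the mixed sense at `t + 1`; the inclusion `C_t ⊆
C_{t+1}` keeps it admissible. Conversely, given a mixed arbitrage at `t`, split both the position
and the closing trade into `K_t`-parts and carried parts `b'`, `b`. The position `b + b'` is
attainable at `t + 1` with zero closing trade, hence vanishes; pointedness of `M` gives `b = b' =
0`, and no arbitrage for `K` applies. This is the backward induction, starting from `K̃_T = K_T`. To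
pass from mixed to full no arbitrage, the carried part of each `K̃_s`-trade is pushed into the next
trade (`exists_solvent_trades`).

Pointwise statements become statements about strategies by measurable selection. For this the graphs
of `K̃_t*` are shown to be analytic; analytic sets are universally measurable, and duals of
universally measurable multifunctions are again universally measurable. -/

section ConvexCones

/-! ### Finite-dimensional closed convex cones and the one-step duality. -/

variable {E : Type*} [NormedAddCommGroup E] [InnerProductSpace ℝ E] [FiniteDimensional ℝ E]

/-- Compactness of the unit sphere of `L × M` gives `c‖(l, m)‖ ≤ ‖l + m‖` with `c > 0`, so bounded
sums come from bounded summands and limits of sums are again sums. -/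
theorem ProperCone.isClosed_add (L M : ProperCone ℝ E) (h : ∀ x ∈ L, -x ∈ M → x = 0) :
    IsClosed ((L : Set E) + (M : Set E)) := by
  have : ProperSpace E := FiniteDimensional.proper ℝ E
  set S : Set (E × E) := (L : Set E) ×ˢ (M : Set E) with hS
  have hSc : IsClosed S := L.isClosed.prod M.isClosed
  have hScomp : IsCompact (S ∩ Metric.sphere 0 1) := (isCompact_sphere 0 1).inter_left hSc
  obtain ⟨c, hc, hcS⟩ : ∃ c > 0, ∀ p ∈ S ∩ Metric.sphere 0 1, c ≤ ‖p.1 + p.2‖ := by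
    rcases (S ∩ Metric.sphere 0 1).eq_empty_or_nonempty with he | hne
    · exact ⟨1, one_pos, by simp [he]⟩
    · obtain ⟨p, hp, hmin⟩ := hScomp.exists_isMinOn hne
        (f := fun p : E × E => ‖p.1 + p.2‖) (by fun_prop)
      refine ⟨‖p.1 + p.2‖, norm_pos_iff.2 fun h0 => ?_, fun q hq => hmin hq⟩
      have h1 : p.1 = 0 := h p.1 hp.1.1 (by
        rw [neg_eq_of_add_eq_zero_right h0]; exact hp.1.2)
      have h2 : p.2 = 0 := by simpa [h1] using h0
      have h3 : p = 0 := Prod.ext h1 h2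
      simpa [h3] using hp.2
  have hbound : ∀ p ∈ S, c * ‖p‖ ≤ ‖p.1 + p.2‖ := by
    intro p hp
    rcases eq_or_ne p 0 with rfl | hp0
    · simp
    have hpos : 0 < ‖p‖ := norm_pos_iff.2 hp0
    have h1 := hcS (‖p‖⁻¹ • p)
      ⟨⟨L.smul_mem hp.1 (by positivity), M.smul_mem hp.2 (by positivity)⟩, by
        simp [norm_smul, hpos.ne']⟩
    rw [Prod.smul_fst, Prod.smul_snd, ← smul_add, norm_smul, norm_inv, norm_norm,
      ← div_eq_inv_mul, le_div_iff₀ hpos] at h1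
    exact h1
  refine isClosed_of_closure_subset fun z hz => ?_
  have h1 : z ∈ closure (Metric.ball z 1 ∩ ((L : Set E) + (M : Set E))) :=
    Metric.isOpen_ball.inter_closure ⟨Metric.mem_ball_self one_pos, hz⟩
  have hK : IsCompact ((fun p : E × E => p.1 + p.2) ''
      (S ∩ Metric.closedBall 0 ((‖z‖ + 1) / c))) :=
    ((isCompact_closedBall _ _).inter_left hSc).image (by fun_prop)
  have h2 : Metric.ball z 1 ∩ ((L : Set E) + (M : Set E)) ⊆ (fun p : E × E => p.1 + p.2) ''
      (S ∩ Metric.closedBall 0 ((‖z‖ + 1) / c)) := by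
    rintro _ ⟨hb, l, hl, m, hm, rfl⟩
    refine ⟨(l, m), ⟨⟨hl, hm⟩, ?_⟩, rfl⟩
    rw [mem_closedBall_zero_iff, le_div_iff₀ hc, mul_comm]
    refine (hbound (l, m) ⟨hl, hm⟩).trans ?_
    have := norm_sub_norm_le (l + m) z
    rw [mem_ball_iff_norm] at hb
    simp only
    linarith
  obtain ⟨p, hp, rfl⟩ := closure_minimal h2 hK.isClosed h1
  exact ⟨p.1, hp.1.1, p.2, hp.1.2, rfl⟩

/-- A dual without interior spans a proper subspace; any vector orthogonal to it lies, with its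
negative, in the bidual `P`. -/
theorem ProperCone.interior_innerDual_nonempty (P : ProperCone ℝ E)
    (h : ∀ x ∈ P, -x ∈ P → x = 0) : (interior (ProperCone.innerDual (P : Set E) : Set E)).Nonempty := by
  have hconv : Convex ℝ (ProperCone.innerDual (P : Set E) : Set E) :=
    (ProperCone.innerDual (P : Set E) : PointedCone ℝ E).convex
  rw [hconv.interior_nonempty_iff_affineSpan_eq_top]
  by_contra hne
  have hspan : Submodule.span ℝ (ProperCone.innerDual (P : Set E) : Set E) ≠ ⊤ := by
    intro h1
    apply hne
    have h0 : (0 : E) ∈ (ProperCone.innerDual (P : Set E) : Set E) := zero_mem _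
    rw [AffineSubspace.affineSpan_eq_top_iff_vectorSpan_eq_top_of_nonempty ℝ E E ⟨0, h0⟩,
      eq_top_iff, ← h1, Submodule.span_le]
    intro x hx
    simpa using vsub_mem_vectorSpan ℝ hx h0
  obtain ⟨v, hv, hv0⟩ := Submodule.exists_mem_ne_zero_of_ne_bot
    (mt Submodule.orthogonal_eq_bot_iff.1 hspan)
  have key : ∀ w ∈ (Submodule.span ℝ (ProperCone.innerDual (P : Set E) : Set E))ᗮ, w ∈ P := by
    intro w hw
    rw [← ProperCone.innerDual_innerDual P, ProperCone.mem_innerDual]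
    intro x hx
    exact ((Submodule.mem_orthogonal _ _).1 hw x (Submodule.subset_span hx)).ge
  exact hv0 (h v (key v hv) (key _ (neg_mem hv)))

theorem nonneg_of_forall_lt_mul {u r : ℝ} (h : ∀ c > 0, u < c * r) : 0 ≤ r := by
  by_contra! hr
  have h1 := h ((|u| + 1) / -r) (div_pos (by positivity) (by linarith))
  rw [div_mul_eq_mul_div, mul_div_assoc, div_neg, div_self hr.ne] at h1
  have := neg_abs_le u
  linarith

/-- Hahn–Banach: a vector strictly separating `y` from the closure is bounded below on the cones `G`
and `C*`, hence nonnegative on them, hence in `C ∩ G*`, where `y` must be nonnegative. -/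
theorem innerDual_subset_closure_closure_convexHull_add (C : ProperCone ℝ E) {G : Set E}
    (h0 : (0 : E) ∈ G) (hG : ∀ c : ℝ, 0 < c → ∀ x ∈ G, c • x ∈ G) :
    (ProperCone.innerDual ((C : Set E) ∩ (ProperCone.innerDual G : Set E)) : Set E) ⊆
      closure (closure (convexHull ℝ G) + (ProperCone.innerDual (C : Set E) : Set E)) := by
  intro y hy
  by_contra hyN
  have hGN : G ⊆ closure (convexHull ℝ G) := (subset_convexHull ℝ G).trans subset_closure
  have hconv : Convex ℝ (closure (convexHull ℝ G) +
      (ProperCone.innerDual (C : Set E) : Set E)) :=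
    (convex_convexHull ℝ G).closure.add (ProperCone.innerDual (C : Set E) : PointedCone ℝ E).convex
  obtain ⟨f, u, hfy, hf⟩ := geometric_hahn_banach_point_closed hconv.closure isClosed_closure hyN
  obtain ⟨v, rfl⟩ := (InnerProductSpace.toDual ℝ E).surjective f
  simp only [InnerProductSpace.toDual_apply_apply] at hfy hf
  have hu : u < 0 := by
    simpa using hf 0 (subset_closure ⟨0, hGN h0, 0, zero_mem _, by simp⟩)
  have hvG : v ∈ ProperCone.innerDual G := by
    rw [ProperCone.mem_innerDual]
    intro x hx
    refine nonneg_of_forall_lt_mul (u := u) fun c hc => ?_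
    have := hf (c • x) (subset_closure ⟨c • x, hGN (hG c hc x hx), 0, zero_mem _, by simp⟩)
    rwa [inner_smul_right, real_inner_comm] at this
  have hvC : v ∈ C := by
    rw [← ProperCone.innerDual_innerDual C, ProperCone.mem_innerDual]
    intro x hx
    refine nonneg_of_forall_lt_mul (u := u) fun c hc => ?_
    have := hf (c • x) (subset_closure ⟨0, hGN h0, c • x,
      (ProperCone.innerDual (C : Set E)).smul_mem hx hc.le, by simp⟩)
    rwa [inner_smul_right, real_inner_comm] at this
  have := (ProperCone.mem_innerDual.1 hy) ⟨hvC, hvG⟩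
  linarith

theorem Convex.interior_closure_subset {s : Set E} (hs : Convex ℝ s)
    (h : (interior (closure s)).Nonempty) : interior (closure s) ⊆ s := by
  have h1 : affineSpan ℝ (closure s) = ⊤ :=
    hs.closure.interior_nonempty_iff_affineSpan_eq_top.1 h
  have h2 : affineSpan ℝ s = ⊤ := by
    rw [eq_top_iff, ← h1, affineSpan_le]
    exact closure_minimal (subset_affineSpan ℝ s) (AffineSubspace.closed_of_finiteDimensional _)
  rw [hs.interior_closure_eq_interior_of_nonempty_interior
    (hs.interior_nonempty_iff_affineSpan_eq_top.2 h2)]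
  exact interior_subset

/-- Duality for the one-step recursion: `K` is the solvency cone, `C` the constraint and `G` the
cone of dual elements of the next period. -/
theorem dual_recursion (K C : ProperCone ℝ E) {G : Set E}
    (h0 : (0 : E) ∈ G) (hG : ∀ c : ℝ, 0 < c → ∀ x ∈ G, c • x ∈ G)
    (hK : ∀ x ∈ K, -x ∈ K → x = 0)
    (hM : ∀ x ∈ C ⊓ ProperCone.innerDual G, -x ∈ C ⊓ ProperCone.innerDual G → x = 0)
    (hKM : ∀ x ∈ K, -x ∈ C ⊓ ProperCone.innerDual G → x = 0) :
    (interior ((ProperCone.innerDual (K : Set E) : Set E) ∩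
      (closure (convexHull ℝ G) + (ProperCone.innerDual (C : Set E) : Set E)))).Nonempty ∧
    ∀ x ∈ ProperCone.innerDual ((ProperCone.innerDual (K : Set E) : Set E) ∩
      (closure (convexHull ℝ G) + (ProperCone.innerDual (C : Set E) : Set E))),
      ∃ b ∈ C ⊓ ProperCone.innerDual G, x - b ∈ K := by
  set M : ProperCone ℝ E := C ⊓ ProperCone.innerDual G with hMdef
  set N := closure (convexHull ℝ G) + (ProperCone.innerDual (C : Set E) : Set E) with hN
  have hMN : (ProperCone.innerDual (M : Set E) : Set E) ⊆ closure N :=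
    innerDual_subset_closure_closure_convexHull_add C h0 hG
  have hNconv : Convex ℝ N :=
    (convex_convexHull ℝ G).closure.add (ProperCone.innerDual (C : Set E) : PointedCone ℝ E).convex
  -- The sum `K + M` is closed because of `hKM`; its dual is the target of the whole argument.
  let P : ProperCone ℝ E :=
    { toSubmodule := (K : PointedCone ℝ E) ⊔ (M : PointedCone ℝ E)
      isClosed' := by
        have := ProperCone.isClosed_add K M hKM
        change IsClosed (((K : PointedCone ℝ E) ⊔ (M : PointedCone ℝ E) : PointedCone ℝ E) : Set E)
        rw [Submodule.coe_sup]
        exact this }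
  have hmemP : ∀ x, x ∈ P ↔ ∃ k ∈ K, ∃ m ∈ M, k + m = x := fun x => Submodule.mem_sup
  have hP : ∀ x ∈ P, -x ∈ P → x = 0 := by
    intro x hx hx'
    obtain ⟨k, hk, m, hm, rfl⟩ := (hmemP x).1 hx
    obtain ⟨k', hk', m', hm', h⟩ := (hmemP _).1 hx'
    have h1 : k + k' = -(m + m') := by
      rw [← sub_eq_zero] at h ⊢; rw [← h]; abel
    have h2 : k + k' = 0 := hKM _ (add_mem hk hk') (by rw [h1, neg_neg]; exact add_mem hm hm')
    have h3 : m + m' = 0 := by rw [h2] at h1; exact neg_eq_zero.1 h1.symm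
    have hk0 : k = 0 := hK k hk (by rwa [neg_eq_of_add_eq_zero_right h2])
    have hm0 : m = 0 := hM m hm (by rwa [neg_eq_of_add_eq_zero_right h3])
    simp [hk0, hm0]
  have hint := ProperCone.interior_innerDual_nonempty P hP
  have hPK : (ProperCone.innerDual (P : Set E) : Set E) ⊆ ProperCone.innerDual (K : Set E) :=
    ProperCone.innerDual_le_innerDual fun x hx => (hmemP x).2 ⟨x, hx, 0, zero_mem _, add_zero x⟩
  have hPM : (ProperCone.innerDual (P : Set E) : Set E) ⊆ ProperCone.innerDual (M : Set E) :=
    ProperCone.innerDual_le_innerDual fun x hx => (hmemP x).2 ⟨0, zero_mem _, x, hx, zero_add x⟩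
  -- The dual of `P` lies only in the closure of `N`, which need not be closed; its interior lies in
  -- `N` itself.
  have hPN : interior (ProperCone.innerDual (P : Set E) : Set E) ⊆
      (ProperCone.innerDual (K : Set E) : Set E) ∩ N := by
    have h1 : interior (ProperCone.innerDual (P : Set E) : Set E) ⊆ interior (closure N) :=
      interior_mono (hPM.trans hMN)
    exact subset_inter (interior_subset.trans hPK)
      (h1.trans (hNconv.interior_closure_subset (hint.mono h1)))
  refine ⟨hint.mono (interior_maximal hPN isOpen_interior), fun x hx => ?_⟩
  have hxP : x ∈ P := by
    rw [← ProperCone.innerDual_innerDual P, ProperCone.mem_innerDual]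
    intro y hy
    have hconv : Convex ℝ (ProperCone.innerDual (P : Set E) : Set E) :=
      (ProperCone.innerDual (P : Set E) : PointedCone ℝ E).convex
    -- The interior is dense in the dual of `P`, so testing `x` against interior points suffices for
    -- the bipolar theorem.
    have hy' : y ∈ closure (interior (ProperCone.innerDual (P : Set E) : Set E)) := by
      rw [hconv.closure_interior_eq_closure_of_nonempty_interior hint]
      exact subset_closure hy
    refine closure_minimal (t := {y | 0 ≤ inner ℝ y x}) (fun z hz => hx (hPN hz))
      (isClosed_le (by fun_prop) (by fun_prop)) hy'
  obtain ⟨k, hk, m, hm, rfl⟩ := (hmemP x).1 hxP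
  exact ⟨m, hm, by simpa using hk⟩

theorem ProperCone.eq_zero_of_interior_innerDual_nonempty (K : ProperCone ℝ E)
    (h : (interior (ProperCone.innerDual (K : Set E) : Set E)).Nonempty) :
    ∀ x ∈ K, -x ∈ K → x = 0 := by
  intro x hx hx'
  obtain ⟨y, hy⟩ := h
  have hzero : ∀ z ∈ ProperCone.innerDual (K : Set E), inner ℝ x z = 0 := by
    intro z hz
    have h1 := (ProperCone.mem_innerDual.1 hz) hx
    have h2 := (ProperCone.mem_innerDual.1 hz) hx'
    rw [inner_neg_left] at h2
    linarith
  obtain ⟨ε, hε, hball⟩ := Metric.isOpen_iff.1 isOpen_interior y hy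
  by_contra hx0
  have hxn : 0 < ‖x‖ := norm_pos_iff.2 hx0
  have h1 := hzero _ (interior_subset (hball (a := y + (ε / 2 / ‖x‖) • x) (by
    rw [mem_ball_iff_norm, add_sub_cancel_left, norm_smul, Real.norm_of_nonneg (by positivity),
      div_mul_cancel₀ _ hxn.ne']
    linarith)))
  rw [inner_add_right, hzero y (interior_subset hy), inner_smul_right, real_inner_self_eq_norm_sq,
    zero_add] at h1
  have : 0 < ε / 2 / ‖x‖ * ‖x‖ ^ 2 := by positivity
  linarith

end ConvexCones

/-! ### Measurable multifunctions and measurable selection. -/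

section Multifunctions

open Filter Topology TopologicalSpace Metric

namespace MeasurableMultifunction

variable {Y : Type*} [MeasurableSpace Y]

theorem const {Z : Type*} [TopologicalSpace Z] (S : Set Z) :
    MeasurableMultifunction fun _ : Y => S := fun _ _ => MeasurableSet.const _

theorem inter_ball {Z : Type*} [PseudoMetricSpace Z] [SecondCountableTopology Z]
    [MeasurableSpace Z] [BorelSpace Z] {F : Y → Set Z} (hF : MeasurableMultifunction F)
    {h : Y → Z} (hh : Measurable h) (r : ℝ) :
    MeasurableSet {y | (F y ∩ ball (h y) r).Nonempty} := by
  obtain ⟨D, hDc, hD⟩ := exists_countable_dense Z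
  -- The moving ball is exhausted by countably many fixed balls with rational radius and centre in a
  -- dense set.
  have : {y | (F y ∩ ball (h y) r).Nonempty} =
      ⋃ q ∈ D, ⋃ ρ : ℚ, {y | (F y ∩ ball q ρ).Nonempty} ∩ {y | dist q (h y) + ρ < r} := by
    ext y
    simp only [mem_ofPred_eq, mem_iUnion, mem_inter_iff, exists_prop]
    constructor
    · rintro ⟨z, hz, hzr⟩
      rw [mem_ball] at hzr
      obtain ⟨q, hq, hzq⟩ := hD.exists_dist_lt z (ε := (r - dist z (h y)) / 3) (by linarith)
      obtain ⟨ρ, hρ1, hρ2⟩ := exists_rat_btwn hzq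
      refine ⟨q, hq, ρ, ⟨z, hz, hρ1⟩, ?_⟩
      have := dist_triangle_left q (h y) z
      linarith
    · rintro ⟨q, -, ρ, ⟨z, hz, hzq⟩, hlt⟩
      refine ⟨z, hz, ?_⟩
      rw [mem_ball] at hzq ⊢
      have := dist_triangle z q (h y)
      linarith
  rw [this]
  exact .biUnion hDc fun q _ => .iUnion fun ρ => (hF _ isOpen_ball).inter
    (measurableSet_lt ((measurable_const.dist hh).add_const _) measurable_const)

/-- Membership in a closed-valued measurable multifunction is a measurable event. -/
theorem measurableSet_mem {Z : Type*} [PseudoMetricSpace Z] [SecondCountableTopology Z]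
    [MeasurableSpace Z] [BorelSpace Z] {F : Y → Set Z} (hF : MeasurableMultifunction F)
    (hFc : ∀ y, IsClosed (F y)) {h : Y → Z} (hh : Measurable h) :
    MeasurableSet {y | h y ∈ F y} := by
  have : {y | h y ∈ F y} = ⋂ n : ℕ, {y | (F y ∩ ball (h y) (1 / (n + 1))).Nonempty} := by
    ext y
    simp only [mem_ofPred_eq, mem_iInter]
    refine ⟨fun hy n => ⟨h y, hy, mem_ball_self (by positivity)⟩, fun hy => ?_⟩
    rw [← (hFc y).closure_eq, Metric.mem_closure_iff]
    intro ε hε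
    obtain ⟨n, hn⟩ := exists_nat_one_div_lt hε
    obtain ⟨z, hz, hzb⟩ := hy n
    exact ⟨z, hz, (mem_ball'.1 hzb).trans hn⟩
  rw [this]
  exact .iInter fun n => hF.inter_ball hh _

/-- A criterion for measurability: it is enough that the events "`F y` meets `ball q (1 / (n + 1))`"
are approximated by measurable ones. -/
theorem of_approx {Z : Type*} [MetricSpace Z] [ProperSpace Z]
    {F : Y → Set Z} (A : ℕ → Z → Set Y) (hA : ∀ n q, MeasurableSet (A n q))
    (h1 : ∀ (n : ℕ) q y, (F y ∩ ball q (1 / (n + 1))).Nonempty → y ∈ A n q)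
    (h2 : ∀ y z, (∀ ε > 0, ∃ᶠ n in atTop, ∃ q ∈ ball z ε, y ∈ A n q) → z ∈ F y) :
    MeasurableMultifunction F := by
  obtain ⟨D, hDc, hD⟩ := exists_countable_dense Z
  -- Compactness turns approximate hits at every scale into a hit: centres near `B` accumulate at a
  -- point of `B`, which `h2` puts in `F y`. Open sets are then countable unions of compact ones.
  have hcomp : ∀ B : Set Z, IsCompact B → MeasurableSet {y | (F y ∩ B).Nonempty} := by
    intro B hB
    have : {y | (F y ∩ B).Nonempty} =
        ⋂ n : ℕ, ⋃ q ∈ D, {_y | (B ∩ ball q (1 / (n + 1))).Nonempty} ∩ A n q := by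
      ext y
      simp only [mem_ofPred_eq, mem_iUnion, mem_inter_iff, exists_prop, mem_iInter]
      constructor
      · rintro ⟨z, hz, hzB⟩ n
        obtain ⟨q, hq, hzq⟩ := hD.exists_dist_lt z (ε := 1 / ((n : ℝ) + 1)) (by positivity)
        exact ⟨q, hq, ⟨z, hzB, hzq⟩, h1 n q y ⟨z, hz, hzq⟩⟩
      · intro h
        choose q hq hqB hqA using h
        choose b hb hbq using hqB
        obtain ⟨z, hz, φ, hφ, hlim⟩ := hB.tendsto_subseq hb
        refine ⟨z, h2 y z fun ε hε => ?_, hz⟩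
        have hev : ∀ᶠ n in atTop, dist (b (φ n)) z < ε / 2 ∧ (1 : ℝ) / ((φ n : ℕ) + 1) < ε / 2 :=
          ((Metric.tendsto_nhds.1 hlim) _ (half_pos hε)).and
            ((tendsto_one_div_add_atTop_nhds_zero_nat.comp hφ.tendsto_atTop).eventually
              (gt_mem_nhds (half_pos hε)))
        refine hφ.tendsto_atTop.frequently (Eventually.frequently ?_)
        filter_upwards [hev] with n hn
        refine ⟨q (φ n), ?_, hqA _⟩
        have h3 := hbq (φ n)
        rw [mem_ball] at h3 ⊢
        have := dist_triangle_left (q (φ n)) z (b (φ n))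
        linarith [hn.1, hn.2]
    rw [this]
    exact .iInter fun n => .biUnion hDc fun q _ => (MeasurableSet.const _).inter (hA n q)
  intro O hO
  obtain ⟨C, hCc, -, rfl, -⟩ := hO.exists_iUnion_isClosed
  have : {y | (F y ∩ ⋃ n, C n).Nonempty} = ⋃ n, ⋃ k : ℕ,
      {y | (F y ∩ (compactCovering Z k ∩ C n)).Nonempty} := by
    ext y
    simp only [mem_ofPred_eq, mem_iUnion]
    constructor
    · rintro ⟨z, hz, hzC⟩
      obtain ⟨n, hn⟩ := mem_iUnion.1 hzC
      obtain ⟨k, hk⟩ := exists_mem_compactCovering z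
      exact ⟨n, k, z, hz, hk, hn⟩
    · rintro ⟨n, k, z, hz, -, hn⟩
      exact ⟨z, hz, mem_iUnion_of_mem n hn⟩
  rw [this]
  exact .iUnion fun n => .iUnion fun k =>
    hcomp _ ((isCompact_compactCovering Z k).inter_right (hCc n))

theorem _root_.mem_of_frequently_inter_ball {Z : Type*} [PseudoMetricSpace Z] {S : Set Z}
    (hS : IsClosed S) {z : Z}
    (h : ∀ ε > 0, ∃ᶠ n : ℕ in atTop, ∃ q ∈ ball z ε, (S ∩ ball q (1 / (n + 1))).Nonempty) :
    z ∈ S := by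
  rw [← hS.closure_eq, Metric.mem_closure_iff]
  intro ε hε
  obtain ⟨n, ⟨q, hq, w, hw, hwq⟩, hn⟩ := ((h _ (half_pos hε)).and_eventually
    (tendsto_one_div_add_atTop_nhds_zero_nat.eventually (gt_mem_nhds (half_pos hε)))).exists
  refine ⟨w, hw, ?_⟩
  rw [mem_ball] at hq hwq
  have := dist_triangle w q z
  rw [dist_comm]
  linarith

theorem inter {Z : Type*} [MetricSpace Z] [ProperSpace Z] {F G : Y → Set Z}
    (hF : MeasurableMultifunction F) (hG : MeasurableMultifunction G)
    (hFc : ∀ y, IsClosed (F y)) (hGc : ∀ y, IsClosed (G y)) :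
    MeasurableMultifunction fun y => F y ∩ G y := by
  refine of_approx (fun n q => {y | (F y ∩ ball q (1 / (n + 1))).Nonempty} ∩
    {y | (G y ∩ ball q (1 / (n + 1))).Nonempty})
    (fun n q => (hF _ isOpen_ball).inter (hG _ isOpen_ball)) ?_ ?_
  · rintro n q y ⟨z, ⟨hz1, hz2⟩, hz⟩
    exact ⟨⟨z, hz1, hz⟩, ⟨z, hz2, hz⟩⟩
  · intro y z h
    exact ⟨mem_of_frequently_inter_ball (hFc y) fun ε hε =>
        (h ε hε).mono fun n ⟨q, hq, hy⟩ => ⟨q, hq, hy.1⟩,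
      mem_of_frequently_inter_ball (hGc y) fun ε hε =>
        (h ε hε).mono fun n ⟨q, hq, hy⟩ => ⟨q, hq, hy.2⟩⟩

section Normed

variable {E : Type*} [NormedAddCommGroup E] [InnerProductSpace ℝ E] [FiniteDimensional ℝ E]

theorem innerDual {U : Y → Set E} (hU : MeasurableMultifunction U) :
    MeasurableMultifunction fun y => (ProperCone.innerDual (U y) : Set E) := by
  have : ProperSpace E := FiniteDimensional.proper ℝ E
  -- Relaxing duality by `‖u‖ / (n + 1)` covers the whole ball around `q`, and the relaxed condition
  -- fails exactly when `U y` meets an open set.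
  refine of_approx (fun n q => {y | ∀ u ∈ U y, -(‖u‖ * (1 / (n + 1))) ≤ inner ℝ u q}) ?_ ?_ ?_
  · intro n q
    have : {y | ∀ u ∈ U y, -(‖u‖ * (1 / ((n : ℝ) + 1))) ≤ inner ℝ u q} =
        {y | (U y ∩ {u | inner ℝ u q < -(‖u‖ * (1 / ((n : ℝ) + 1)))}).Nonempty}ᶜ := by
      ext y
      simp only [mem_ofPred_eq, mem_compl_iff, not_nonempty_iff_eq_empty,
        eq_empty_iff_forall_notMem, mem_inter_iff, not_and, not_lt]
    rw [this]
    exact (hU _ (isOpen_lt (by fun_prop) (by fun_prop))).compl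
  · rintro n q y ⟨z, hz, hzq⟩ u hu
    have h1 := (ProperCone.mem_innerDual.1 hz) hu
    have h2 : inner ℝ u z - inner ℝ u q ≤ ‖u‖ * (1 / (n + 1)) := by
      rw [← inner_sub_right]
      refine (real_inner_le_norm _ _).trans ?_
      gcongr
      exact (mem_ball_iff_norm.1 hzq).le
    linarith
  · intro y z h
    rw [SetLike.mem_coe, ProperCone.mem_innerDual]
    intro u hu
    refine le_of_forall_pos_le_add fun ε hε => ?_
    -- With this `δ` the displacement from `q` to `z` and the relaxation each cost at most `ε / 2`.
    have hδ : 0 < ε / (2 * (‖u‖ + 1)) := by positivity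
    obtain ⟨n, ⟨q, hq, hy⟩, hn⟩ := ((h _ hδ).and_eventually
      (tendsto_one_div_add_atTop_nhds_zero_nat.eventually (gt_mem_nhds hδ))).exists
    have h1 := hy u hu
    have h2 : inner ℝ u q - inner ℝ u z ≤ ‖u‖ * (ε / (2 * (‖u‖ + 1))) := by
      rw [← inner_sub_right]
      refine (real_inner_le_norm _ _).trans ?_
      gcongr
      exact (mem_ball_iff_norm.1 hq).le
    have h3 : ‖u‖ * (1 / ((n : ℝ) + 1)) ≤ ‖u‖ * (ε / (2 * (‖u‖ + 1))) := by gcongr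
    have h4 : ‖u‖ * (ε / (2 * (‖u‖ + 1))) ≤ ε / 2 := by
      rw [← div_div, mul_div_assoc']
      rw [div_le_iff₀ (by positivity)]
      nlinarith [norm_nonneg u]
    linarith

theorem const_sub [MeasurableSpace E] [BorelSpace E] {F : Y → Set E}
    (hF : MeasurableMultifunction F) (hFc : ∀ y, IsClosed (F y)) {h : Y → E} (hh : Measurable h) :
    MeasurableMultifunction fun y => {b | h y - b ∈ F y} := by
  have : ProperSpace E := FiniteDimensional.proper ℝ E
  refine of_approx (fun n q => {y | (F y ∩ ball (h y - q) (1 / (n + 1))).Nonempty})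
    (fun n q => hF.inter_ball (hh.sub_const q) _) ?_ ?_
  · rintro n q y ⟨z, hz, hzq⟩
    refine ⟨h y - z, hz, ?_⟩
    rwa [mem_ball, dist_sub_left, ← mem_ball]
  · intro y z hz
    refine mem_of_frequently_inter_ball (hFc y) fun ε hε => (hz ε hε).mono ?_
    rintro n ⟨q, hq, hy⟩
    exact ⟨h y - q, by rwa [mem_ball, dist_sub_left, ← mem_ball], hy⟩

end Normed

/-- The measurable selection theorem of Kuratowski and Ryll-Nardzewski. -/
theorem exists_measurable_selection {Z : Type*} [MetricSpace Z] [CompleteSpace Z]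
    [SecondCountableTopology Z] [MeasurableSpace Z] [BorelSpace Z] {F : Y → Set Z}
    (hF : MeasurableMultifunction F) (hFc : ∀ y, IsClosed (F y)) (z₀ : Z) :
    ∃ f : Y → Z, Measurable f ∧ (∀ y, (F y).Nonempty → f y ∈ F y) ∧
      ∀ y, F y = ∅ → f y = z₀ := by
  classical
  have : Nonempty Z := ⟨z₀⟩
  wlog hne : ∀ y, (F y).Nonempty generalizing F
  · set G : Y → Set Z := fun y => if (F y).Nonempty then F y else {z₀} with hG
    have hdom : MeasurableSet {y | (F y).Nonempty} := by simpa using hF univ isOpen_univ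
    obtain ⟨f, hf, hfG, -⟩ := this (F := G) (by
      intro O hO
      have : {y | (G y ∩ O).Nonempty} = {y | (F y ∩ O).Nonempty} ∪
          ({y | (F y).Nonempty}ᶜ ∩ {_y | z₀ ∈ O}) := by
        ext y
        by_cases hy : (F y).Nonempty
        · simp [hG, hy]
        · simp [hG, not_nonempty_iff_eq_empty.1 hy]
      rw [this]
      exact (hF O hO).union (hdom.compl.inter (MeasurableSet.const _))) (by
      intro y
      by_cases hy : (F y).Nonempty
      · simpa [hG, hy] using hFc y
      · simp [hG, hy]) (by
      intro y
      by_cases hy : (F y).Nonempty <;> simp [hG, hy])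
    have hG' : ∀ y, f y ∈ G y := fun y => hfG y (by
      by_cases hy : (F y).Nonempty <;> simp [hG, hy])
    refine ⟨f, hf, fun y hy => by simpa [hG, hy] using hG' y, fun y hy => by
      simpa [hG, hy] using hG' y⟩
  have pick : ∀ S : ℕ → Set Y, (∀ i, MeasurableSet (S i)) → (∀ y, ∃ i, y ∈ S i) →
      ∃ g : Y → Z, Measurable g ∧ ∀ y, ∃ i, y ∈ S i ∧ g y = denseSeq Z i := by
    intro S hS hcov
    refine ⟨fun y => denseSeq Z (Nat.find (hcov y)),
      Measurable.find (p := fun i y => y ∈ S i) (f := fun i _ => denseSeq Z i) (fun i => measurable_const) hS hcov,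
      fun y => ⟨_, Nat.find_spec (hcov y), rfl⟩⟩
  let r : ℕ → ℝ := fun n => (1 / 2) ^ n
  have hr : ∀ n, 0 < r n := fun n => by positivity
  -- Measurable approximate selections at distance less than `2⁻ⁿ`. Consecutive ones can be kept
  -- within `2 * r n`, so they converge, and the limit lies in the closed set `F y`.
  let Q : ℕ → (Y → Z) → Prop := fun n f => Measurable f ∧ ∀ y, (F y ∩ ball (f y) (r n)).Nonempty
  have hstart : ∃ f, Q 0 f := by
    obtain ⟨g, hg, hg'⟩ := pick (fun i => {y | (F y ∩ ball (denseSeq Z i) (r 0)).Nonempty})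
      (fun i => hF _ isOpen_ball) (by
        intro y
        obtain ⟨z, hz⟩ := hne y
        obtain ⟨i, hi⟩ := (denseRange_denseSeq Z).exists_dist_lt z (hr 0)
        exact ⟨i, z, hz, hi⟩)
    refine ⟨g, hg, fun y => ?_⟩
    obtain ⟨i, hi, h⟩ := hg' y
    rw [h]
    exact hi
  have hstep : ∀ n f, Q n f → ∃ g, Q (n + 1) g ∧ ∀ y, dist (f y) (g y) ≤ 2 * r n := by
    rintro n f ⟨hf, hf'⟩
    obtain ⟨g, hg, hg'⟩ := pick
      (fun i => {y | (F y ∩ ball (denseSeq Z i) (r (n + 1))).Nonempty} ∩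
        {y | dist (f y) (denseSeq Z i) < 2 * r n})
      (fun i => (hF _ isOpen_ball).inter
        (measurableSet_lt (hf.dist measurable_const) measurable_const)) (by
        intro y
        obtain ⟨z, hz, hzf⟩ := hf' y
        obtain ⟨i, hi⟩ := (denseRange_denseSeq Z).exists_dist_lt z (hr (n + 1))
        refine ⟨i, ⟨z, hz, hi⟩, ?_⟩
        have h1 : r (n + 1) = r n / 2 := by simp only [r, pow_succ]; ring
        have h2 := dist_triangle_left (f y) (denseSeq Z i) z
        rw [mem_ball] at hzf
        have := hr n
        simp only [mem_ofPred_eq]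
        linarith)
    refine ⟨g, ⟨hg, fun y => ?_⟩, fun y => ?_⟩
    · obtain ⟨i, hi, h⟩ := hg' y
      rw [h]
      exact hi.1
    · obtain ⟨i, hi, h⟩ := hg' y
      rw [h]
      exact hi.2.le
  choose next hnext hdist using hstep
  obtain ⟨f₀, hf₀⟩ := hstart
  let s : (n : ℕ) → {f // Q n f} := fun n =>
    Nat.rec (motive := fun n => {f // Q n f}) ⟨f₀, hf₀⟩
      (fun n f => ⟨next n f.1 f.2, hnext n f.1 f.2⟩) n
  have hcau : ∀ y, CauchySeq fun n => (s n).1 y := fun y =>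
    cauchySeq_of_le_geometric (1 / 2) 2 (by norm_num) fun n => hdist n (s n).1 (s n).2 y
  choose f hf using fun y => cauchySeq_tendsto_of_complete (hcau y)
  refine ⟨f, measurable_of_tendsto_metrizable (fun n => (s n).2.1) (tendsto_pi_nhds.2 hf),
    fun y _ => ?_, fun y hy => ((hne y).ne_empty hy).elim⟩
  rw [← (hFc y).closure_eq, Metric.mem_closure_iff]
  intro ε hε
  have hr0 : Tendsto r atTop (𝓝 0) :=
    tendsto_pow_atTop_nhds_zero_of_lt_one (by norm_num) (by norm_num)
  obtain ⟨n, hn1, hn2⟩ := (((Metric.tendsto_nhds.1 (hf y)) _ (half_pos hε)).and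
    (hr0.eventually (gt_mem_nhds (half_pos hε)))).exists
  obtain ⟨z, hz, hzb⟩ := (s n).2.2 y
  refine ⟨z, hz, ?_⟩
  rw [mem_ball] at hzb
  have := dist_triangle_left (f y) z ((s n).1 y)
  rw [dist_comm z] at hzb
  linarith

end MeasurableMultifunction

end Multifunctions

/-! ### Capacitability of analytic sets, for one measure and for measurable families of measures. -/

section Capacity

open Filter Topology ProbabilityTheory

/-- The sequences whose first `n` terms are dominated by those of `τ`. -/
def dominatedBelow (n : ℕ) (τ : ℕ → ℕ) : Set (ℕ → ℕ) := {ρ | ∀ i < n, ρ i ≤ τ i}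

theorem dominatedBelow_congr {n : ℕ} {τ τ' : ℕ → ℕ} (h : ∀ i < n, τ i = τ' i) :
    dominatedBelow n τ = dominatedBelow n τ' := by
  ext ρ
  exact forall₂_congr fun i hi => by rw [h i hi]

theorem antitone_dominatedBelow (τ : ℕ → ℕ) : Antitone fun n => dominatedBelow n τ :=
  fun _ _ hmn _ hρ i hi => hρ i (hi.trans_le hmn)

/-- Bounding one more coordinate by `k` gives sets increasing with `k`; continuity from below, valid
for outer measures, lets `k` be chosen without losing the bound `c`. -/
theorem exists_forall_lt_measure_image_dominatedBelow {W : Type*} [MeasurableSpace W]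
    (μ : Measure W) (f : (ℕ → ℕ) → W) {c : ENNReal} (hc : c < μ (range f)) :
    ∃ τ : ℕ → ℕ, ∀ n, c < μ (f '' dominatedBelow n τ) := by
  have step : ∀ (n : ℕ) (τ : ℕ → ℕ), c < μ (f '' dominatedBelow n τ) →
      ∃ k, c < μ (f '' dominatedBelow (n + 1) (Function.update τ n k)) := by
    intro n τ h
    have hmono : Monotone fun k =>
        f '' dominatedBelow (n + 1) (Function.update τ n k) := by
      intro k l hkl
      refine image_mono fun ρ hρ i hi => ?_
      refine (hρ i hi).trans ?_
      rcases eq_or_ne i n with rfl | hne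
      · simpa using hkl
      · simp [hne]
    have hU : f '' dominatedBelow n τ =
        ⋃ k, f '' dominatedBelow (n + 1) (Function.update τ n k) := by
      rw [← image_iUnion]
      congr 1
      ext ρ
      simp only [mem_iUnion]
      constructor
      · intro hρ
        refine ⟨ρ n, fun i hi => ?_⟩
        rcases eq_or_ne i n with rfl | hne
        · simp
        · simpa [hne] using hρ i (by omega)
      · rintro ⟨k, hk⟩ i hi
        simpa [hi.ne] using hk i (by omega)
    rw [hU, hmono.measure_iUnion] at h
    exact lt_iSup_iff.1 h
  choose! k hk using step
  let s : (n : ℕ) → {τ : ℕ → ℕ // c < μ (f '' dominatedBelow n τ)} := fun n =>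
    Nat.rec (motive := fun n => {τ : ℕ → ℕ // c < μ (f '' dominatedBelow n τ)})
      ⟨0, by simpa [dominatedBelow] using hc⟩
      (fun n τ => ⟨Function.update τ.1 n (k n τ.1), hk n τ.1 τ.2⟩) n
  have hs : ∀ i m, i < m → (s m).1 i = (s (i + 1)).1 i := by
    intro i m him
    induction m, him using Nat.le_induction with
    | base => rfl
    | succ m hm ih =>
      have h1 : (s (m + 1)).1 = Function.update (s m).1 m (k m (s m).1) := rfl
      rw [h1, Function.update_of_ne (by omega), ih]
  -- Coordinate `n` is fixed at stage `n + 1` and never altered, so the diagonal agrees with stage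
  -- `n` below `n`.
  refine ⟨fun n => (s (n + 1)).1 n, fun n => ?_⟩
  rw [dominatedBelow_congr (τ' := (s n).1) fun i hi => (hs i n hi).symm]
  exact (s n).2

theorem iInter_closure_image_dominatedBelow_subset {W : Type*} [TopologicalSpace W]
    [TopologicalSpace.MetrizableSpace W] {f : (ℕ → ℕ) → W} (hf : Continuous f) (τ : ℕ → ℕ) :
    ⋂ n, closure (f '' dominatedBelow n τ) ⊆ range f := by
  let := TopologicalSpace.metrizableSpaceMetric W
  intro w hw
  rw [mem_iInter] at hw
  have h1 : ∀ n : ℕ, ∃ ρ ∈ dominatedBelow n τ, dist w (f ρ) < 1 / (n + 1) := by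
    intro n
    obtain ⟨_, ⟨ρ, hρ, rfl⟩, h⟩ := Metric.mem_closure_iff.1 (hw n) (1 / (n + 1)) (by positivity)
    exact ⟨ρ, hρ, h⟩
  choose ρ hρ hdist using h1
  -- Coordinate `i` of `ρ n` is at most `τ i` once `n > i`; the finitely many earlier terms are
  -- absorbed by the supremum.
  have hK : IsCompact (pi univ fun i => Iic ((Finset.range (i + 1)).sup (fun n => ρ n i) ⊔ τ i)) :=
    isCompact_univ_pi fun i => (finite_Iic _).isCompact
  obtain ⟨σ, -, φ, hφ, hlim⟩ := hK.tendsto_subseq (x := ρ) (by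
    intro n i _
    rcases le_or_gt n i with h | h
    · exact (Finset.le_sup (f := fun n => ρ n i) (Finset.mem_range.2 (by omega))).trans le_sup_left
    · exact (hρ n i h).trans le_sup_right)
  refine ⟨σ, tendsto_nhds_unique ((hf.tendsto σ).comp hlim) ?_⟩
  have h2 : Tendsto (fun n => f (ρ n)) atTop (𝓝 w) := by
    rw [tendsto_iff_dist_tendsto_zero]
    refine squeeze_zero (fun _ => dist_nonneg) (fun n => ?_)
      tendsto_one_div_add_atTop_nhds_zero_nat
    rw [dist_comm]
    exact (hdist n).le
  exact h2.comp hφ.tendsto_atTop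

theorem le_measure_iInter_closure_image_dominatedBelow {W : Type*} [TopologicalSpace W]
    [MeasurableSpace W] [OpensMeasurableSpace W] (μ : Measure W) [IsFiniteMeasure μ]
    (f : (ℕ → ℕ) → W) {c : ENNReal} {τ : ℕ → ℕ}
    (h : ∀ n, c ≤ μ (closure (f '' dominatedBelow n τ))) :
    c ≤ μ (⋂ n, closure (f '' dominatedBelow n τ)) := by
  rw [Antitone.measure_iInter
    (fun m n hmn => closure_mono (image_mono (antitone_dominatedBelow τ hmn)))
    (fun n => isClosed_closure.measurableSet.nullMeasurableSet) ⟨0, measure_ne_top _ _⟩]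
  exact le_iInf h

/-- Analytic sets are universally measurable. -/
theorem MeasureTheory.AnalyticSet.nullMeasurableSet {W : Type*} [TopologicalSpace W]
    [TopologicalSpace.MetrizableSpace W] [MeasurableSpace W] [OpensMeasurableSpace W] {s : Set W}
    (hs : AnalyticSet s) (μ : Measure W) [IsFiniteMeasure μ] : NullMeasurableSet s μ := by
  rw [AnalyticSet] at hs
  rcases hs with rfl | ⟨f, hf, rfl⟩
  · exact .empty
  rcases eq_or_ne (μ (range f)) 0 with h0 | h0
  · exact NullMeasurableSet.of_null h0
  obtain ⟨c, -, hc, hlim⟩ := exists_seq_strictMono_tendsto' (pos_iff_ne_zero.2 h0)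
  choose τ hτ using fun n =>
    exists_forall_lt_measure_image_dominatedBelow μ f (hc n).2
  -- A Borel subset of the analytic set with the same outer measure, since its measure is at least
  -- every `c n`.
  set B := ⋃ n, ⋂ m, closure (f '' dominatedBelow m (τ n)) with hB
  have hBm : MeasurableSet B :=
    .iUnion fun n => .iInter fun m => isClosed_closure.measurableSet
  have hBs : B ⊆ range f :=
    iUnion_subset fun n => iInter_closure_image_dominatedBelow_subset hf (τ n)
  refine hBm.nullMeasurableSet.congr (ae_eq_of_subset_of_measure_ge hBs
    (le_of_tendsto' hlim fun n => ?_) hBm.nullMeasurableSet (measure_ne_top _ _))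
  exact (le_measure_iInter_closure_image_dominatedBelow μ f
    fun m => (hτ n m).le.trans (measure_mono subset_closure)).trans
    (measure_mono (subset_iUnion (fun n => ⋂ m, closure (f '' dominatedBelow m (τ n))) n))

/-- Only finitely many coordinates of the sequence matter, so joint measurability reduces to a
countable parameter. -/
theorem measurableSet_le_kernel_section {Y X : Type*} [MeasurableSpace Y] [MeasurableSpace X]
    (κ : Kernel Y X) [IsFiniteKernel κ] (c : ENNReal) (n : ℕ) {F : (ℕ → ℕ) → Set (Y × X)}
    (hF : ∀ τ, MeasurableSet (F τ)) (hFn : ∀ τ τ', (∀ i < n, τ i = τ' i) → F τ = F τ') :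
    MeasurableSet {p : Y × (ℕ → ℕ) | c ≤ κ p.1 (Prod.mk p.1 ⁻¹' F p.2)} := by
  let e : (Fin n → ℕ) → ℕ → ℕ := fun s i => if h : i < n then s ⟨i, h⟩ else 0
  have hFe : ∀ τ, F τ = F (e fun i => τ i) := fun τ => hFn _ _ fun i hi => by simp [e, hi]
  have hmeas : Measurable fun q : Y × (Fin n → ℕ) => κ q.1 (Prod.mk q.1 ⁻¹' F (e q.2)) :=
    measurable_from_prod_countable_left fun s => Kernel.measurable_kernel_prodMk_left (hF (e s))
  have h1 : Measurable fun p : Y × (ℕ → ℕ) => (p.1, fun i : Fin n => p.2 i) := by fun_prop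
  have h2 : {p : Y × (ℕ → ℕ) | c ≤ κ p.1 (Prod.mk p.1 ⁻¹' F p.2)} =
      {p : Y × (ℕ → ℕ) | c ≤ κ p.1 (Prod.mk p.1 ⁻¹' F (e fun i => p.2 i))} := by
    ext p
    rw [mem_ofPred_eq, mem_ofPred_eq, hFe p.2]
  rw [h2]
  exact measurableSet_le measurable_const (hmeas.comp h1)

/-- The points at which a kernel charges the section of an analytic set form an analytic set. -/
theorem MeasureTheory.AnalyticSet.setOf_kernel_pos {Y X : Type*} [TopologicalSpace Y]
    [PolishSpace Y] [MeasurableSpace Y] [BorelSpace Y] [TopologicalSpace X] [PolishSpace X]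
    [MeasurableSpace X] [BorelSpace X] (κ : Kernel Y X) [IsFiniteKernel κ] {A : Set (Y × X)}
    (hA : AnalyticSet A) : AnalyticSet {y | 0 < κ y (Prod.mk y ⁻¹' A)} := by
  rw [AnalyticSet] at hA
  rcases hA with rfl | ⟨f, hf, rfl⟩
  · simpa using analyticSet_empty
  have hmap : ∀ y (s : Set (Y × X)), (κ y).map (Prod.mk y) s = κ y (Prod.mk y ⁻¹' s) :=
    fun y s => (measurableEmbedding_prodMk_left y).map_apply _ _
  -- By capacitability, charging the section is witnessed by some `τ` and a lower bound `1 / m`;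
  -- this exhibits the set as the projection of a Borel set.
  have key : {y | 0 < κ y (Prod.mk y ⁻¹' range f)} = Prod.fst ''
      ⋃ m : ℕ, ⋂ n, {p : Y × (ℕ → ℕ) | (m : ENNReal)⁻¹ ≤
        κ p.1 (Prod.mk p.1 ⁻¹' closure (f '' dominatedBelow n p.2))} := by
    ext y
    simp only [mem_ofPred_eq, mem_image, mem_iUnion, mem_iInter, Prod.exists, exists_and_right,
      exists_eq_right]
    constructor
    · intro h
      rw [← hmap] at h
      obtain ⟨c, hc0, hc⟩ := exists_between h
      obtain ⟨τ, hτ⟩ := exists_forall_lt_measure_image_dominatedBelow _ f hc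
      obtain ⟨m, hm⟩ := ENNReal.exists_inv_nat_lt hc0.ne'
      refine ⟨τ, m, fun n => ?_⟩
      rw [← hmap]
      exact hm.le.trans ((hτ n).le.trans (measure_mono subset_closure))
    · rintro ⟨τ, m, h⟩
      rw [← hmap]
      refine lt_of_lt_of_le (b := (m : ENNReal)⁻¹) (by simp) ?_
      refine (le_measure_iInter_closure_image_dominatedBelow ((κ y).map (Prod.mk y)) f
        fun n => ?_).trans (measure_mono (iInter_closure_image_dominatedBelow_subset hf τ))
      rw [hmap]
      exact h n
  rw [key]
  refine AnalyticSet.image_of_continuous (MeasurableSet.analyticSet ?_) continuous_fst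
  refine .iUnion fun m => .iInter fun n => ?_
  exact measurableSet_le_kernel_section κ _ n
    (F := fun τ => closure (f '' dominatedBelow n τ))
    (fun τ => isClosed_closure.measurableSet)
    (fun τ τ' h => by rw [dominatedBelow_congr h])

/-- By the portmanteau theorem, the mass of a closed set is upper semicontinuous for weak
convergence. -/
theorem Continuous.measurable_probabilityMeasure {B X : Type*} [TopologicalSpace B]
    [MeasurableSpace B] [OpensMeasurableSpace B] [TopologicalSpace X] [HasOuterApproxClosed X]
    [MeasurableSpace X] [BorelSpace X] {g : B → ProbabilityMeasure X} (hg : Continuous g) :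
    Measurable fun b => (g b : Measure X) := by
  refine Measurable.measure_of_isPiSystem_of_isProbabilityMeasure
    (BorelSpace.measurable_eq.trans borel_eq_generateFrom_isClosed) isPiSystem_isClosed
    fun F hF => measurable_of_Iio fun y => IsOpen.measurableSet ?_
  rw [isOpen_iff_eventually]
  intro b hb
  exact eventually_lt_of_limsup_lt
    ((ProbabilityMeasure.limsup_measure_closed_le_of_tendsto (hg.tendsto b) hF).trans_lt hb)

/-- If a correspondence `R` with values in the probability measures has an analytic graph, the
points at which some element of `R` charges the section of an analytic set form an analytic set. -/
theorem MeasureTheory.AnalyticSet.setOf_exists_measure_pos {Y X : Type*} [TopologicalSpace Y]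
    [TopologicalSpace X] [PolishSpace X] [MeasurableSpace X] [BorelSpace X] [T2Space Y]
    {R : Y → Set (ProbabilityMeasure X)}
    (hR : AnalyticSet {p : Y × ProbabilityMeasure X | p.2 ∈ R p.1}) {A : Set (Y × X)}
    (hA : AnalyticSet A) :
    AnalyticSet {y | ∃ P ∈ R y, 0 < (P : Measure X) (Prod.mk y ⁻¹' A)} := by
  rw [AnalyticSet] at hR
  rcases hR with h | ⟨g, hg, hgR⟩
  · have : {y | ∃ P ∈ R y, 0 < (P : Measure X) (Prod.mk y ⁻¹' A)} = ∅ := by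
      refine eq_empty_of_forall_notMem ?_
      rintro y ⟨P, hP, -⟩
      exact (h.subset (show (y, P) ∈ {p : Y × ProbabilityMeasure X | p.2 ∈ R p.1} from hP))
    rw [this]
    exact analyticSet_empty
  -- A continuous parametrization `g` of the graph of `R` turns the existential over measures into a
  -- single kernel, followed by a continuous image.
  let κ : Kernel (ℕ → ℕ) X :=
    ⟨fun b => ((g b).2 : Measure X), (continuous_snd.comp hg).measurable_probabilityMeasure⟩
  have : IsMarkovKernel κ := ⟨fun b => (g b).2.2⟩
  have h1 : AnalyticSet ((fun p : (ℕ → ℕ) × X => ((g p.1).1, p.2)) ⁻¹' A) :=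
    hA.preimage (by fun_prop)
  convert! (h1.setOf_kernel_pos κ).image_of_continuous (continuous_fst.comp hg) using 1
  ext y
  constructor
  · rintro ⟨P, hP, hpos⟩
    have h2 : (y, P) ∈ range g := by rw [hgR]; exact hP
    obtain ⟨b, hb⟩ := h2
    refine ⟨b, ?_, by simp [hb]⟩
    change 0 < ((g b).2 : Measure X) (Prod.mk (g b).1 ⁻¹' A)
    rw [hb]
    exact hpos
  · rintro ⟨b, hpos, rfl⟩
    exact ⟨(g b).2, hgR.subset (mem_range_self b), hpos⟩

end Capacity

/-! ### Multifunctions with analytic graph and their stability properties. -/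

section AnalyticMultifunctions

open Filter Topology TopologicalSpace Metric

theorem MeasureTheory.AnalyticSet.inter {α : Type*} [TopologicalSpace α] [T2Space α] {s t : Set α}
    (hs : AnalyticSet s) (ht : AnalyticSet t) : AnalyticSet (s ∩ t) := by
  rw [inter_eq_iInter]
  exact AnalyticSet.iInter fun b => by cases b <;> assumption

/-- A multifunction is analytic if its graph is an analytic set. -/
def AnalyticMultifunction {Y Z : Type*} [TopologicalSpace Y] [TopologicalSpace Z]
    (U : Y → Set Z) : Prop :=
  AnalyticSet {p : Y × Z | p.2 ∈ U p.1}

namespace AnalyticMultifunction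

theorem iUnion {Y Z : Type*} [TopologicalSpace Y] [TopologicalSpace Z] {W : ℕ → Y → Set Z} (hW : ∀ n, AnalyticMultifunction (W n)) :
    AnalyticMultifunction fun y => ⋃ n, W n y := by
  rw [AnalyticMultifunction]
  convert! AnalyticSet.iUnion hW using 1
  ext p
  simp

variable {Y : Type*} [TopologicalSpace Y] [PolishSpace Y]

section Polish

variable {Z : Type*} [TopologicalSpace Z] [PolishSpace Z] {U V : Y → Set Z}

theorem analyticSet_hits (hU : AnalyticMultifunction U) {O : Set Z} (hO : IsOpen O) :
    AnalyticSet {y | (U y ∩ O).Nonempty} := by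
  have h1 : AnalyticSet ({p : Y × Z | p.2 ∈ U p.1} ∩ Prod.snd ⁻¹' O) := by
    borelize Z Y
    exact AnalyticSet.inter hU (hO.preimage continuous_snd).measurableSet.analyticSet
  convert! h1.image_of_continuous continuous_fst using 1
  ext y
  simp [Set.Nonempty]

/-- Closed values are recovered from the hits of countably many small balls. -/
theorem of_analyticSet_hits (hc : ∀ y, IsClosed (U y))
    (h : ∀ O : Set Z, IsOpen O → AnalyticSet {y | (U y ∩ O).Nonempty}) :
    AnalyticMultifunction U := by
  let := metrizableSpaceMetric Z
  obtain ⟨D, hDc, hD⟩ := exists_countable_dense Z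
  have := hDc.to_subtype
  have key : {p : Y × Z | p.2 ∈ U p.1} = ⋂ n : ℕ, ⋃ q : D,
      (Prod.fst ⁻¹' {y | (U y ∩ ball (q : Z) (1 / (n + 1))).Nonempty}) ∩
        (Prod.snd ⁻¹' ball (q : Z) (1 / (n + 1))) := by
    ext ⟨y, z⟩
    simp only [mem_ofPred_eq, mem_iInter, mem_iUnion, mem_inter_iff, mem_preimage]
    constructor
    · intro hz n
      obtain ⟨q, hq, hzq⟩ := hD.exists_dist_lt z (ε := 1 / ((n : ℝ) + 1)) (by positivity)
      exact ⟨⟨q, hq⟩, ⟨z, hz, hzq⟩, hzq⟩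
    · intro hz
      refine mem_of_frequently_inter_ball (hc y) fun ε hε => Eventually.frequently ?_
      filter_upwards [tendsto_one_div_add_atTop_nhds_zero_nat.eventually (gt_mem_nhds hε)]
        with n hn
      obtain ⟨q, hq, hzq⟩ := hz n
      exact ⟨q, (mem_ball'.1 hzq).trans hn, hq⟩
  rw [AnalyticMultifunction, key]
  refine AnalyticSet.iInter fun n => AnalyticSet.iUnion fun q => ?_
  refine ((h _ isOpen_ball).preimage continuous_fst).inter ?_
  borelize Y Z
  exact (isOpen_ball.preimage continuous_snd).measurableSet.analyticSet

theorem closure (hU : AnalyticMultifunction U) : AnalyticMultifunction fun y => closure (U y) := by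
  refine of_analyticSet_hits (fun _ => isClosed_closure) fun O hO => ?_
  simp_rw [closure_inter_open_nonempty_iff hO]
  exact hU.analyticSet_hits hO

theorem inter (hU : AnalyticMultifunction U) (hV : AnalyticMultifunction V) :
    AnalyticMultifunction fun y => U y ∩ V y :=
  AnalyticSet.inter hU hV

theorem of_measurable [MeasurableSpace Y] [BorelSpace Y] [MeasurableSpace Z] [BorelSpace Z]
    (hU : MeasurableMultifunction U)
    (hc : ∀ y, IsClosed (U y)) : AnalyticMultifunction U := by
  let := metrizableSpaceMetric Z
  have h1 : MeasurableMultifunction fun p : Y × Z => U p.1 := fun O hO => measurable_fst (hU O hO)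
  exact (h1.measurableSet_mem (fun p => hc p.1) measurable_snd).analyticSet

theorem add [Add Z] [ContinuousAdd Z] (hU : AnalyticMultifunction U)
    (hV : AnalyticMultifunction V) : AnalyticMultifunction fun y => U y + V y := by
  have h1 : AnalyticSet ({p : Y × Z × Z | p.2.1 ∈ U p.1} ∩ {p : Y × Z × Z | p.2.2 ∈ V p.1}) :=
    (AnalyticSet.preimage hU (f := fun p : Y × Z × Z => (p.1, p.2.1)) (by fun_prop)).inter
      (AnalyticSet.preimage hV (f := fun p : Y × Z × Z => (p.1, p.2.2)) (by fun_prop))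
  rw [AnalyticMultifunction]
  convert! h1.image_of_continuous (f := fun p : Y × Z × Z => (p.1, p.2.1 + p.2.2))
    (by fun_prop) using 1
  ext ⟨y, z⟩
  constructor
  · rintro ⟨a, ha, b, hb, rfl⟩
    exact ⟨(y, a, b), ⟨ha, hb⟩, rfl⟩
  · rintro ⟨⟨y', a, b⟩, ⟨ha, hb⟩, h⟩
    simp only [Prod.mk.injEq] at h
    obtain ⟨rfl, rfl⟩ := h
    exact ⟨a, ha, b, hb, rfl⟩

end Polish

end AnalyticMultifunction

theorem smul_mem_convexHull {E : Type*} [AddCommGroup E] [Module ℝ E] {G : Set E} {c : ℝ}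
    (hG : ∀ x ∈ G, c • x ∈ G) {x : E} (hx : x ∈ convexHull ℝ G) : c • x ∈ convexHull ℝ G := by
  have h1 : c • G ⊆ G := by
    rintro _ ⟨y, hy, rfl⟩
    exact hG y hy
  exact convexHull_mono h1 (by
    rw [convexHull_smul]
    exact smul_mem_smul_set hx)

/-- The convex hull of a cone consists of the finite sums of its elements. -/
theorem convexHull_eq_iUnion_add_iterate {E : Type*} [AddCommGroup E] [Module ℝ E] {G : Set E}
    (h0 : (0 : E) ∈ G) (hG : ∀ c : ℝ, 0 < c → ∀ x ∈ G, c • x ∈ G) :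
    convexHull ℝ G = ⋃ n : ℕ, (fun S => S + G)^[n] G := by
  have hsucc : ∀ n, (fun S => S + G)^[n + 1] G = (fun S => S + G)^[n] G + G := fun n =>
    Function.iterate_succ_apply' _ _ _
  have hzero : ∀ n, (0 : E) ∈ (fun S => S + G)^[n] G := by
    intro n
    induction n with
    | zero => exact h0
    | succ n ih => rw [hsucc]; exact ⟨0, ih, 0, h0, add_zero 0⟩
  have hsmul : ∀ n, ∀ c : ℝ, 0 ≤ c → ∀ x ∈ (fun S => S + G)^[n] G,
      c • x ∈ (fun S => S + G)^[n] G := by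
    intro n c hc
    rcases hc.eq_or_lt with rfl | hc
    · intro x _
      rw [zero_smul]
      exact hzero n
    induction n with
    | zero => exact hG c hc
    | succ n ih =>
      rw [hsucc]
      rintro _ ⟨a, ha, b, hb, rfl⟩
      exact ⟨c • a, ih a ha, c • b, hG c hc b hb, (smul_add _ _ _).symm⟩
  have hadd : ∀ n m, ∀ x ∈ (fun S => S + G)^[n] G, ∀ y ∈ (fun S => S + G)^[m] G,
      x + y ∈ (fun S => S + G)^[n + m + 1] G := by
    intro n m
    induction m with
    | zero =>
      intro x hx y hy
      rw [hsucc]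
      exact ⟨x, hx, y, hy, rfl⟩
    | succ m ih =>
      intro x hx y hy
      rw [hsucc] at hy
      obtain ⟨a, ha, b, hb, rfl⟩ := hy
      rw [show n + (m + 1) + 1 = (n + m + 1) + 1 by ring, hsucc]
      exact ⟨x + a, ih x hx a ha, b, hb, add_assoc _ _ _⟩
  refine subset_antisymm (convexHull_min (fun x hx => mem_iUnion.2 ⟨0, hx⟩) ?_)
    (iUnion_subset fun n => ?_)
  · intro x hx y hy a b ha hb _
    obtain ⟨n, hn⟩ := mem_iUnion.1 hx
    obtain ⟨m, hm⟩ := mem_iUnion.1 hy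
    exact mem_iUnion.2 ⟨_, hadd n m _ (hsmul n a ha x hn) _ (hsmul m b hb y hm)⟩
  · induction n with
    | zero => exact subset_convexHull ℝ G
    | succ n ih =>
      rw [hsucc]
      rintro _ ⟨x, hx, y, hy, rfl⟩
      -- The sum `x + y` is the midpoint of `2x` and `2y`.
      have h1 := (convex_convexHull ℝ G) (smul_mem_convexHull (hG 2 two_pos) (ih hx))
        (smul_mem_convexHull (hG 2 two_pos) (subset_convexHull ℝ G hy))
        (a := 1 / 2) (b := 1 / 2) (by norm_num) (by norm_num) (by norm_num)
      simpa [smul_smul] using h1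

theorem AnalyticMultifunction.convexHull {Y : Type*} [TopologicalSpace Y] [PolishSpace Y]
    {E : Type*} [AddCommGroup E] [Module ℝ E] [TopologicalSpace E] [PolishSpace E]
    [ContinuousAdd E] {U : Y → Set E} (hU : AnalyticMultifunction U) (h0 : ∀ y, (0 : E) ∈ U y)
    (hcone : ∀ y, ∀ c : ℝ, 0 < c → ∀ x ∈ U y, c • x ∈ U y) :
    AnalyticMultifunction fun y => convexHull ℝ (U y) := by
  simp_rw [fun y => convexHull_eq_iUnion_add_iterate (h0 y) (hcone y)]
  refine .iUnion fun n => ?_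
  induction n with
  | zero => exact hU
  | succ n ih =>
    simp_rw [Function.iterate_succ_apply']
    exact ih.add hU

end AnalyticMultifunctions

/-! ### Universal measurability of sets, maps and multifunctions. -/

section UniversalCompletion

theorem MeasurableSet.universalCompletion {Y : Type*} [MeasurableSpace Y] {s : Set Y}
    (hs : MeasurableSet s) : MeasurableSet[universalCompletion Y] s :=
  fun _ => hs.nullMeasurableSet

theorem Measurable.univMeasurable {Y Z : Type*} [MeasurableSpace Y] [MeasurableSpace Z] {f : Y → Z}
    (hf : Measurable f) : UnivMeasurable f :=
  fun _ hs => (hf hs).universalCompletion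

theorem MeasureTheory.AnalyticSet.universalCompletion {Y : Type*} [TopologicalSpace Y]
    [TopologicalSpace.MetrizableSpace Y] [MeasurableSpace Y] [OpensMeasurableSpace Y] {s : Set Y}
    (hs : AnalyticSet s) : MeasurableSet[universalCompletion Y] s :=
  fun P => hs.nullMeasurableSet (P : Measure Y)

theorem measurableSet_universalCompletion_preimage {Y Z : Type*} [MeasurableSpace Y]
    [MeasurableSpace Z] {f : Y → Z} (hf : Measurable f) {s : Set Z}
    (hs : MeasurableSet[universalCompletion Z] s) :
    MeasurableSet[universalCompletion Y] (f ⁻¹' s) := fun P =>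
  (hs (P.map hf.aemeasurable)).preimage ⟨hf, Measure.AbsolutelyContinuous.rfl⟩

theorem UnivMeasurable.comp_measurable {Y Z W : Type*} [MeasurableSpace Y] [MeasurableSpace Z]
    [MeasurableSpace W] {g : Z → W} (hg : UnivMeasurable g) {f : Y → Z} (hf : Measurable f) :
    UnivMeasurable fun y => g (f y) :=
  fun _ hs => measurableSet_universalCompletion_preimage hf (hg hs)

/-- Multifunctions that are measurable with respect to the universal completion. -/
abbrev UnivMeasurableMultifunction {Y Z : Type*} [MeasurableSpace Y] [TopologicalSpace Z]
    (U : Y → Set Z) : Prop :=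
  @MeasurableMultifunction Y Z (universalCompletion Y) _ U

theorem MeasurableMultifunction.univMeasurableMultifunction {Y Z : Type*} [MeasurableSpace Y]
    [TopologicalSpace Z] {U : Y → Set Z} (hU : MeasurableMultifunction U) :
    UnivMeasurableMultifunction U := fun O hO => (hU O hO).universalCompletion

theorem AnalyticMultifunction.univMeasurableMultifunction {Y Z : Type*} [TopologicalSpace Y]
    [PolishSpace Y] [MeasurableSpace Y] [BorelSpace Y] [TopologicalSpace Z] [PolishSpace Z]
    {U : Y → Set Z} (hU : AnalyticMultifunction U) : UnivMeasurableMultifunction U :=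
  fun _ hO => (hU.analyticSet_hits hO).universalCompletion

end UniversalCompletion

/-! ### Quasi-sure supports. -/

section Supports

open TopologicalSpace

theorem isClosed_qsSupport {Y Z : Type*} [MeasurableSpace Y] [TopologicalSpace Z]
    (R : Set (ProbabilityMeasure Y)) (U : Y → Set Z) : IsClosed (qsSupport R U) :=
  isClosed_sInter fun _ hF => hF.1

/-- If no prior charges the hits of `O`, then `Oᶜ` competes in the definition of the support. This
form is what makes the support analytic in the parameter. -/
theorem qsSupport_inter_nonempty_iff {Y Z : Type*} [MeasurableSpace Y] [TopologicalSpace Z]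
    [SecondCountableTopology Z] (R : Set (ProbabilityMeasure Y)) (U : Y → Set Z) {O : Set Z}
    (hO : IsOpen O) : (qsSupport R U ∩ O).Nonempty ↔
      ∃ P ∈ R, 0 < (P : Measure Y) {y | (U y ∩ O).Nonempty} := by
  constructor
  · intro h
    by_contra! hP
    obtain ⟨z, hz, hzO⟩ := h
    refine hz Oᶜ ⟨hO.isClosed_compl, fun P hPR => ?_⟩ hzO
    have h1 : (P : Measure Y) {y | (U y ∩ O).Nonempty} = 0 := nonpos_iff_eq_zero.1 (hP P hPR)
    rw [measure_eq_zero_iff_ae_notMem] at h1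
    filter_upwards [h1] with y hy w hw hwO
    exact hy ⟨w, hw, hwO⟩
  · rintro ⟨P, hP, hpos⟩
    by_contra h
    refine hpos.ne' ?_
    rw [measure_eq_zero_iff_ae_notMem]
    filter_upwards [quasiSurely_subset_qsSupport R U P hP] with y hy
    rintro ⟨w, hw, hwO⟩
    exact h ⟨w, hy hw, hwO⟩

theorem mem_qsSupport_of_forall_mem {Y Z : Type*} [MeasurableSpace Y] [TopologicalSpace Z]
    {R : Set (ProbabilityMeasure Y)} (hR : R.Nonempty) {U : Y → Set Z} {z : Z}
    (hz : ∀ y, z ∈ U y) : z ∈ qsSupport R U := by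
  rintro F ⟨-, hF⟩
  -- Without any prior the support would be empty.
  obtain ⟨P, hP⟩ := hR
  obtain ⟨y, hy⟩ := (hF P hP).exists
  exact hy (hz y)

theorem smul_mem_qsSupport {Y E : Type*} [MeasurableSpace Y] [TopologicalSpace E]
    [AddCommGroup E] [Module ℝ E] [ContinuousConstSMul ℝ E]
    {R : Set (ProbabilityMeasure Y)} {U : Y → Set E} {c : ℝ}
    (hU : ∀ y, ∀ x ∈ U y, c • x ∈ U y) {x : E} (hx : x ∈ qsSupport R U) :
    c • x ∈ qsSupport R U := by
  rintro F ⟨hFc, hF⟩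
  refine hx ((fun z => c • z) ⁻¹' F) ⟨hFc.preimage (continuous_const_smul c), fun P hP => ?_⟩
  filter_upwards [hF P hP] with y hy z hz
  exact hy (hU y z hz)

end Supports

/-! ### Paths, and analyticity of the recursively defined dual cones. -/

section Recursion

variable {X : Type*}

theorem Traj.extend_upTo {t : ℕ} (ω : Traj X t) (x : X) : (ω.extend x).upTo t = ω := by
  funext i
  have h : (⟨min (i : ℕ) (t + 1), Nat.lt_succ_of_le (Nat.min_le_right _ _)⟩ : Fin (t + 2)) =
      i.castSucc := by
    ext
    have := i.2
    simp only [Fin.val_castSucc]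
    omega
  change Fin.snoc (α := fun _ => X) ω x _ = _
  rw [h]
  exact Fin.snoc_castSucc (α := fun _ => X) x ω i

theorem Traj.upTo_upTo {t m s : ℕ} (hsm : s ≤ m) (ω : Traj X t) :
    (ω.upTo m).upTo s = ω.upTo s := by
  funext i
  have := i.2
  simp only [Traj.upTo]
  congr 2
  omega

theorem Traj.upTo_self {t : ℕ} (ω : Traj X t) : ω.upTo t = ω := by
  funext i
  have := i.2
  simp only [Traj.upTo]
  congr 1
  ext
  simp only
  omega

theorem Traj.continuous_extend [TopologicalSpace X] (t : ℕ) :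
    Continuous fun p : Traj X t × X => p.1.extend p.2 := by
  refine continuous_pi fun i => ?_
  refine Fin.lastCases ?_ (fun j => ?_) i
  · simpa [Traj.extend] using continuous_snd
  · simp only [Traj.extend, Fin.snoc_castSucc]
    fun_prop

variable [MeasurableSpace X]

theorem Traj.measurable_extend (t : ℕ) : Measurable fun p : Traj X t × X => p.1.extend p.2 := by
  rw [measurable_pi_iff]
  intro i
  refine Fin.lastCases ?_ (fun j => ?_) i
  · simpa [Traj.extend] using measurable_snd
  · simp only [Traj.extend, Fin.snoc_castSucc]
    fun_prop

theorem Traj.measurable_extend_left {t : ℕ} (ω : Traj X t) : Measurable ω.extend :=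
  (Traj.measurable_extend t).comp measurable_prodMk_left

theorem Traj.measurable_upTo (t s : ℕ) : Measurable fun ω : Traj X t => ω.upTo s :=
  measurable_pi_iff.2 fun _ => measurable_pi_apply _

variable {d T : ℕ} {R : (t : ℕ) → Traj X t → Set (ProbabilityMeasure X)} {K C : ConeFamily X d}

/-- The quasi-sure support `Γ_t` of the dual cones of the next period. -/
def dualSupport (T : ℕ) (R : (t : ℕ) → Traj X t → Set (ProbabilityMeasure X))
    (K C : ConeFamily X d) (t : ℕ) (ω : Traj X t) : Set (Pos d) :=
  qsSupport (R t ω) fun x => tildeDual T R K C (t + 1) (ω.extend x)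

theorem smul_mem_tildeDual {c : ℝ} (hc : 0 < c) {t : ℕ} (ht : t ≤ T) :
    ∀ ω : Traj X t, ∀ x ∈ tildeDual T R K C t ω, c • x ∈ tildeDual T R K C t ω := by
  refine Nat.decreasingInduction (motive := fun t _ => ∀ ω : Traj X t,
    ∀ x ∈ tildeDual T R K C t ω, c • x ∈ tildeDual T R K C t ω) ?_ ?_ ht
  · intro t ht ih ω
    rw [tildeDual_of_lt ht]
    rintro _ ⟨hxK, a, ha, b, hb, rfl⟩
    refine ⟨ProperCone.smul_mem _ hxK hc.le, c • a, ?_, c • b,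
      ProperCone.smul_mem _ hb hc.le, (smul_add _ _ _).symm⟩
    refine map_mem_closure (continuous_const_smul c) ha fun x hx => ?_
    exact smul_mem_convexHull (fun y hy => smul_mem_qsSupport (fun x => ih (ω.extend x)) hy) hx
  · intro ω x hx
    rw [tildeDual_last] at hx ⊢
    exact ProperCone.smul_mem _ hx hc.le

theorem smul_mem_dualSupport {c : ℝ} (hc : 0 < c) {t : ℕ} (ht : t < T) (ω : Traj X t) :
    ∀ x ∈ dualSupport T R K C t ω, c • x ∈ dualSupport T R K C t ω := fun _ hx =>
  smul_mem_qsSupport (fun x => smul_mem_tildeDual hc (Nat.succ_le_of_lt ht) (ω.extend x)) hx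

theorem zero_mem_tildeDual (hR_ne : ∀ t < T, ∀ ω, (R t ω).Nonempty) {t : ℕ} (ht : t ≤ T) :
    ∀ ω : Traj X t, (0 : Pos d) ∈ tildeDual T R K C t ω := by
  refine Nat.decreasingInduction (motive := fun t _ => ∀ ω : Traj X t,
    (0 : Pos d) ∈ tildeDual T R K C t ω) ?_ ?_ ht
  · intro t ht ih ω
    rw [tildeDual_of_lt ht]
    refine ⟨zero_mem _, 0, subset_closure (subset_convexHull ℝ _ ?_), 0, zero_mem _, add_zero 0⟩
    exact mem_qsSupport_of_forall_mem (hR_ne t ht ω) fun x => ih (ω.extend x)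
  · intro ω
    rw [tildeDual_last]
    exact zero_mem _

theorem zero_mem_dualSupport (hR_ne : ∀ t < T, ∀ ω, (R t ω).Nonempty) {t : ℕ} (ht : t < T)
    (ω : Traj X t) : (0 : Pos d) ∈ dualSupport T R K C t ω :=
  mem_qsSupport_of_forall_mem (hR_ne t ht ω)
    fun x => zero_mem_tildeDual hR_ne (Nat.succ_le_of_lt ht) (ω.extend x)

variable [TopologicalSpace X] [PolishSpace X] [BorelSpace X]

theorem analyticMultifunction_dualSupport {t : ℕ}
    (hR_an : AnalyticSet {p : Traj X t × ProbabilityMeasure X | p.2 ∈ R t p.1})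
    (h : AnalyticMultifunction (tildeDual T R K C (t + 1))) :
    AnalyticMultifunction (dualSupport T R K C t) := by
  refine .of_analyticSet_hits (fun ω => isClosed_qsSupport _ _) fun O hO => ?_
  simp_rw [dualSupport, qsSupport_inter_nonempty_iff _ _ hO]
  exact hR_an.setOf_exists_measure_pos
    ((h.analyticSet_hits hO).preimage (Traj.continuous_extend t))

/-- Analyticity of the graph is the property that survives every operation of the recursion:
support, convex hull, closure, sum and intersection. The support projects along the graph of `R`, so
Borel measurability need not survive. -/
theorem analyticMultifunction_tildeDual (hR_ne : ∀ t < T, ∀ ω, (R t ω).Nonempty)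
    (hR_an : ∀ t < T, AnalyticSet {p : Traj X t × ProbabilityMeasure X | p.2 ∈ R t p.1})
    (hK_meas : ∀ t ≤ T, MeasurableMultifunction fun ω => (K t ω : Set (Pos d)))
    (hC_meas : ∀ t ≤ T, MeasurableMultifunction fun ω => (C t ω : Set (Pos d)))
    {t : ℕ} (ht : t ≤ T) : AnalyticMultifunction (tildeDual T R K C t) := by
  refine Nat.decreasingInduction (motive := fun t _ =>
    AnalyticMultifunction (tildeDual T R K C t)) ?_ ?_ ht
  · intro t ht ih
    rw [funext (tildeDual_of_lt ht R K C)]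
    refine .inter (.of_measurable (hK_meas t ht.le).innerDual fun ω => ProperCone.isClosed _)
      (.add (.closure (AnalyticMultifunction.convexHull ?_ ?_ ?_))
        (.of_measurable (hC_meas t ht.le).innerDual fun ω => ProperCone.isClosed _))
    · exact analyticMultifunction_dualSupport (hR_an t ht) ih
    · exact zero_mem_dualSupport hR_ne ht
    · exact fun ω c hc => smul_mem_dualSupport hc ht ω
  · rw [funext (tildeDual_last T R K C)]
    exact .of_measurable (hK_meas T le_rfl).innerDual fun ω => ProperCone.isClosed _

end Recursion

/-! ### Marginals and one-step disintegration of the priors. -/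

section Priors

variable {X : Type*} [MeasurableSpace X] [MeasurableSpace.CountablyGenerated X]

theorem map_upTo_pathLaw (μ : ProbabilityMeasure X)
    (κ : (t : ℕ) → Traj X t → ProbabilityMeasure X) {t m : ℕ} (htm : t ≤ m)
    (hκ : ∀ s < m, UnivMeasurable (κ s)) :
    (pathLaw μ κ m).map (fun ω => ω.upTo t) = pathLaw μ κ t := by
  induction m, htm using Nat.le_induction with
  | base => simp [Traj.upTo_self]
  | succ m hm ih =>
    have hκ' : ∀ s < m, UnivMeasurable (κ s) := fun s hs => hκ s (by omega)
    have := isProbabilityMeasure_pathLaw μ κ m hκ'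
    rw [← ih hκ']
    ext s hs
    rw [Measure.map_apply (Traj.measurable_upTo _ _) hs,
      Measure.map_apply (Traj.measurable_upTo _ _) hs, pathLaw,
      Measure.bind_apply (Traj.measurable_upTo _ _ hs) (aemeasurable_kernel (hκ m (by omega)) _),
      ← lintegral_indicator_one (Traj.measurable_upTo _ _ hs)]
    refine lintegral_congr fun ω => ?_
    rw [Measure.map_apply ω.measurable_extend_left (Traj.measurable_upTo _ _ hs)]
    have h1 : ∀ x, (ω.extend x).upTo t = ω.upTo t := fun x => by
      rw [← Traj.upTo_upTo hm, Traj.extend_upTo]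
    by_cases h : ω.upTo t ∈ s
    · simp [preimage, h1, h]
    · simp [preimage, h1, h]

variable {T : ℕ} {R₀ : Set (ProbabilityMeasure X)}
  {R : (t : ℕ) → Traj X t → Set (ProbabilityMeasure X)}

/-- One-step disintegration: a universally measurable property which holds `R_t(ω)`-quasi-surely
at time `t + 1` for every `ω` holds quasi-surely. -/
theorem quasiSurely_priors_succ {t : ℕ} (ht : t < T) {p : Traj X (t + 1) → Prop}
    (hp : MeasurableSet[universalCompletion _] {ω | p ω})
    (h : ∀ ω, QuasiSurely (R t ω) fun x => p (ω.extend x)) :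
    QuasiSurely (priors T R₀ R) fun ω => p (ω.upTo (t + 1)) := by
  rintro P ⟨μ, -, κ, hκ, hP⟩
  have hκ' : ∀ s < t + 1, UnivMeasurable (κ s) := fun s hs => (hκ s (by omega)).1
  have := isProbabilityMeasure_pathLaw μ κ (t + 1) hκ'
  have := isProbabilityMeasure_pathLaw μ κ t fun s hs => hκ' s (by omega)
  have hmap := map_upTo_pathLaw μ κ (Nat.succ_le_of_lt ht) fun s hs => (hκ s hs).1
  rw [hP]
  refine ae_of_ae_map (Traj.measurable_upTo _ _).aemeasurable ?_
  rw [hmap]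
  have hnull : NullMeasurableSet {ω | p ω}ᶜ (pathLaw μ κ (t + 1)) :=
    (hp ⟨pathLaw μ κ (t + 1), inferInstance⟩).compl
  -- The exceptional set is only universally measurable; a measurable subset of full measure in it
  -- can be integrated against the kernels.
  obtain ⟨N, hNs, hN, hNae⟩ := hnull.exists_measurable_subset_ae_eq
  have h0 : pathLaw μ κ (t + 1) N = 0 := by
    rw [pathLaw, Measure.bind_apply hN (aemeasurable_kernel (hκ t ht).1 _)]
    refine (lintegral_congr fun ω => ?_).trans lintegral_zero
    rw [Measure.map_apply ω.measurable_extend_left hN,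
      measure_eq_zero_iff_ae_notMem]
    filter_upwards [h ω (κ t ω) ((hκ t ht).2 ω)] with x hx hxN
    exact hNs hxN hx
  rw [ae_iff]
  exact (measure_congr hNae).symm.trans h0

end Priors

/-! ### Arithmetic of universally measurable maps. -/

section UnivMeasurableArithmetic

variable {Y E : Type*} [MeasurableSpace Y] [AddCommGroup E] [MeasurableSpace E]

theorem UnivMeasurable.add [MeasurableAdd₂ E] {f g : Y → E} (hf : UnivMeasurable f) (hg : UnivMeasurable g) :
    UnivMeasurable fun y => f y + g y :=
  Measurable.add (m := universalCompletion Y) hf hg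

theorem UnivMeasurable.sub [MeasurableSub₂ E] {f g : Y → E} (hf : UnivMeasurable f) (hg : UnivMeasurable g) :
    UnivMeasurable fun y => f y - g y :=
  Measurable.sub (m := universalCompletion Y) hf hg

theorem UnivMeasurable.neg [MeasurableNeg E] {f : Y → E} (hf : UnivMeasurable f) : UnivMeasurable fun y => -f y :=
  @Measurable.neg _ _ _ _ _ (universalCompletion Y) _ hf

theorem univMeasurable_const {Z : Type*} [MeasurableSpace Z] (z : Z) :
    UnivMeasurable fun _ : Y => z := measurable_const.univMeasurable

theorem UnivMeasurable.sum [MeasurableAdd₂ E] {ι : Type*} (s : Finset ι) {f : ι → Y → E}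
    (hf : ∀ i ∈ s, UnivMeasurable (f i)) : UnivMeasurable fun y => ∑ i ∈ s, f i y :=
  @Finset.measurable_fun_sum E ι Y _ _ _ (universalCompletion Y) _ s hf

end UnivMeasurableArithmetic

theorem UnivMeasurable.ite {Y Z : Type*} [MeasurableSpace Y] [MeasurableSpace Z] {f g : Y → Z} {s : Set Y} [DecidablePred (· ∈ s)]
    (hs : MeasurableSet[universalCompletion Y] s)
    (hf : UnivMeasurable f) (hg : UnivMeasurable g) :
    UnivMeasurable fun y => if y ∈ s then f y else g y :=
  Measurable.ite (m := universalCompletion Y) hs hf hg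

/-! ### No strict arbitrage with quasi-sure constraints. -/

section NoArbitrage

variable {X : Type*} [MeasurableSpace X] {d T : ℕ}

/-- No strict arbitrage at time `t` in quasi-sure form, with the cones `K_s` before time `t` and
the cone `L_t` at time `t`; the last trade is the one that closes the balance. -/
def NoStrictArbitrageAt (Pr : Set (ProbabilityMeasure (Traj X T))) (K C L : ConeFamily X d)
    (t : ℕ) : Prop :=
  ∀ (ξ : Traj X t → Pos d) (k : (s : ℕ) → Traj X s → Pos d), UnivMeasurable ξ →
    (∀ s < t, UnivMeasurable (k s) ∧
      QuasiSurely Pr fun ω => k s (ω.upTo s) ∈ K s (ω.upTo s)) →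
    (QuasiSurely Pr fun ω => ξ (ω.upTo t) ∈ C t (ω.upTo t)) →
    (QuasiSurely Pr fun ω => ξ (ω.upTo t) ∈ L t (ω.upTo t)) →
    (QuasiSurely Pr fun ω =>
      -(ξ (ω.upTo t) + ∑ s ∈ Finset.range t, k s (ω.upTo s)) ∈ L t (ω.upTo t)) →
    QuasiSurely Pr fun ω => ξ (ω.upTo t) = 0

theorem univMeasurable_balance {t : ℕ} {ξ : Traj X t → Pos d} {k : (s : ℕ) → Traj X s → Pos d}
    (hξ : UnivMeasurable ξ) (hk : ∀ s < t, UnivMeasurable (k s)) :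
    UnivMeasurable fun ω => -(ξ ω + ∑ s ∈ Finset.range t, k s (ω.upTo s)) :=
  (hξ.add (.sum _ fun s hs => (hk s (Finset.mem_range.1 hs)).comp_measurable
    (Traj.measurable_upTo t s))).neg

theorem NoStrictArbitrage.noStrictArbitrageAt {Pr : Set (ProbabilityMeasure (Traj X T))}
    {K C : ConeFamily X d} (hNA : NoStrictArbitrage Pr K C) {t : ℕ} (ht : t ≤ T)
    (hK : MeasurableMultifunction fun ω => (K t ω : Set (Pos d)))
    (hC : MeasurableMultifunction fun ω => (C t ω : Set (Pos d))) :
    NoStrictArbitrageAt Pr K C K t := by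
  classical
  intro ξ k hξ hk hξC hξK hbal
  -- `NoStrictArbitrage` requires selectors at every point, so `ξ` is replaced by `0` off the
  -- universally measurable set where both constraints hold.
  set S : Set (Traj X t) := {ω | ξ ω ∈ (C t ω : Set (Pos d))} ∩ {ω | ξ ω ∈ (K t ω : Set (Pos d))}
    with hS
  have hSm : MeasurableSet[universalCompletion _] S :=
    (@MeasurableMultifunction.measurableSet_mem _ (universalCompletion _) _ _ _ _ _ _
      hC.univMeasurableMultifunction (fun ω => (C t ω).isClosed) ξ hξ).inter
    (@MeasurableMultifunction.measurableSet_mem _ (universalCompletion _) _ _ _ _ _ _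
      hK.univMeasurableMultifunction (fun ω => (K t ω).isClosed) ξ hξ)
  let kt : Traj X t → Pos d := fun ω => -(ξ ω + ∑ s ∈ Finset.range t, k s (ω.upTo s))
  have hkt : ∀ ω : Traj X T, kt (ω.upTo t) =
      -(ξ (ω.upTo t) + ∑ s ∈ Finset.range t, k s (ω.upTo s)) := by
    intro ω
    simp only [kt]
    rw [Finset.sum_congr rfl fun s hs => by rw [Traj.upTo_upTo (Finset.mem_range.1 hs).le]]
  have h := hNA t ht (fun ω => if ω ∈ S then ξ ω else 0)
    ⟨.ite hSm hξ (univMeasurable_const 0), fun ω => ?_, Function.update k t kt, fun s hs => ?_, ?_⟩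
    (fun ω => ?_)
  · intro P hP
    filter_upwards [h P hP, hξC P hP, hξK P hP] with ω h1 h2 h3
    rwa [if_pos ⟨h2, h3⟩] at h1
  · beta_reduce
    split_ifs with h
    exacts [h.1, zero_mem _]
  · rcases hs.eq_or_lt with rfl | hs
    · rw [Function.update_self]
      refine ⟨univMeasurable_balance hξ fun s hs => (hk s hs).1, fun P hP => ?_⟩
      filter_upwards [hbal P hP] with ω h1
      rwa [hkt]
    · rw [Function.update_of_ne hs.ne]
      exact hk s hs
  · intro P hP
    filter_upwards [hξC P hP, hξK P hP] with ω h2 h3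
    rw [if_pos ⟨h2, h3⟩, Finset.sum_range_succ, Function.update_self, hkt,
      Finset.sum_congr rfl fun s hs => by
        rw [Function.update_of_ne (Finset.mem_range.1 hs).ne], Finset.sum_neg_distrib]
    abel
  · beta_reduce
    split_ifs with h
    exacts [h.2, zero_mem _]

end NoArbitrage

/-! ### Carried positions and their solvency one date later. -/

section Model

variable {X : Type*} [MeasurableSpace X]
  {d T : ℕ} {R₀ : Set (ProbabilityMeasure X)}
  {R : (t : ℕ) → Traj X t → Set (ProbabilityMeasure X)} {K C : ConeFamily X d}

/-- The admissible positions at time `t` which are quasi-surely solvent at time `t + 1` for the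
cones `K̃_{t+1}`. -/
noncomputable def carryCone (T : ℕ) (R : (t : ℕ) → Traj X t → Set (ProbabilityMeasure X)) (K C : ConeFamily X d)
    (t : ℕ) (ω : Traj X t) : ProperCone ℝ (Pos d) :=
  C t ω ⊓ ProperCone.innerDual (dualSupport T R K C t ω)

theorem exists_univMeasurable_selection {t : ℕ} {F : Traj X t → Set (Pos d)}
    (hF : UnivMeasurableMultifunction F) (hFc : ∀ ω, IsClosed (F ω)) :
    ∃ f : Traj X t → Pos d, UnivMeasurable f ∧ (∀ ω, (F ω).Nonempty → f ω ∈ F ω) ∧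
      ∀ ω, F ω = ∅ → f ω = 0 :=
  @MeasurableMultifunction.exists_measurable_selection _ (universalCompletion _) _ _ _ _ _ _ _ hF
    hFc 0

variable [TopologicalSpace X] [PolishSpace X] [BorelSpace X]

/-- The conclusions of the one-step argument at time `t`. -/
structure OneStepDecomposition (T : ℕ) (R₀ : Set (ProbabilityMeasure X))
    (R : (t : ℕ) → Traj X t → Set (ProbabilityMeasure X)) (K C : ConeFamily X d) (t : ℕ) : Prop where
  interior_nonempty : QuasiSurely (priors T R₀ R) fun ω =>
    (interior (tildeDual T R K C t (ω.upTo t))).Nonempty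
  decomposition : ∀ ξ : Traj X t → Pos d, UnivMeasurable ξ →
    (QuasiSurely (priors T R₀ R) fun ω => ξ (ω.upTo t) ∈ tildeCone T R K C t (ω.upTo t)) →
    ∃ b : Traj X t → Pos d, UnivMeasurable b ∧ (∀ ω, b ω ∈ carryCone T R K C t ω) ∧
      QuasiSurely (priors T R₀ R) fun ω => ξ (ω.upTo t) - b (ω.upTo t) ∈ K t (ω.upTo t)
  pointed : QuasiSurely (priors T R₀ R) fun ω =>
    ∀ x ∈ carryCone T R K C t (ω.upTo t), -x ∈ carryCone T R K C t (ω.upTo t) → x = 0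

/-- The measurability assumptions on the model. -/
structure MeasurableModel (T : ℕ) (R : (t : ℕ) → Traj X t → Set (ProbabilityMeasure X))
    (K C : ConeFamily X d) : Prop where
  nonempty : ∀ t < T, ∀ ω, (R t ω).Nonempty
  analytic : ∀ t < T, AnalyticSet {p : Traj X t × ProbabilityMeasure X | p.2 ∈ R t p.1}
  measurable_solvency : ∀ t ≤ T, MeasurableMultifunction fun ω => (K t ω : Set (Pos d))
  measurable_constraint : ∀ t ≤ T, MeasurableMultifunction fun ω => (C t ω : Set (Pos d))

namespace MeasurableModel

theorem univMeasurableMultifunction_tildeCone (hM : MeasurableModel T R K C) {t : ℕ} (ht : t ≤ T) :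
    UnivMeasurableMultifunction fun ω => (tildeCone T R K C t ω : Set (Pos d)) :=
  @MeasurableMultifunction.innerDual _ (universalCompletion _) _ _ _ _ _
    (analyticMultifunction_tildeDual hM.nonempty hM.analytic hM.measurable_solvency
      hM.measurable_constraint ht).univMeasurableMultifunction

theorem univMeasurableMultifunction_carryCone (hM : MeasurableModel T R K C) {t : ℕ} (ht : t < T) :
    UnivMeasurableMultifunction fun ω => (carryCone T R K C t ω : Set (Pos d)) :=
  @MeasurableMultifunction.inter _ (universalCompletion _) _ _ _ _ _
    (hM.measurable_constraint t ht.le).univMeasurableMultifunction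
    (@MeasurableMultifunction.innerDual _ (universalCompletion _) _ _ _ _ _
      (analyticMultifunction_dualSupport (hM.analytic t ht)
        (analyticMultifunction_tildeDual hM.nonempty hM.analytic hM.measurable_solvency
          hM.measurable_constraint ht)).univMeasurableMultifunction)
    (fun ω => (C t ω).isClosed) (fun _ => ProperCone.isClosed _)

/-- A vector of the dual of the support is nonnegative on `K̃*_{t+1}`, which lies q.s. in the
support; disintegration makes this q.s. under the priors. -/
theorem quasiSurely_mem_tildeCone (hM : MeasurableModel T R K C) {t : ℕ} (ht : t < T) {x : Traj X t → Pos d}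
    (hx : UnivMeasurable x) (hxM : ∀ ω, x ω ∈ carryCone T R K C t ω) :
    QuasiSurely (priors T R₀ R) fun ω =>
      x (ω.upTo t) ∈ tildeCone T R K C (t + 1) (ω.upTo (t + 1)) := by
  have h := quasiSurely_priors_succ (R₀ := R₀) (R := R) ht
    (p := fun ω => x (ω.upTo t) ∈ (tildeCone T R K C (t + 1) ω : Set (Pos d)))
    (@MeasurableMultifunction.measurableSet_mem _ (universalCompletion _) _ _ _ _ _ _
      (hM.univMeasurableMultifunction_tildeCone ht) (fun ω => ProperCone.isClosed _) _
      (hx.comp_measurable (Traj.measurable_upTo _ _)))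
    (by
      intro ω P hP
      filter_upwards [quasiSurely_subset_qsSupport (R t ω)
        (fun x => tildeDual T R K C (t + 1) (ω.extend x)) P hP] with y hy
      rw [Traj.extend_upTo]
      intro z hz
      exact (hxM ω).2 (hy hz))
  intro P hP
  filter_upwards [h P hP] with ω hω
  rwa [Traj.upTo_upTo (Nat.le_succ t)] at hω

/-- A position that can be carried over to time `t + 1` and that, together with the preceding
trades, has a balance in `K̃_{t+1}` vanishes. -/
theorem quasiSurely_eq_zero_of_carryCone (hM : MeasurableModel T R K C)
    (hC_mono : ∀ t < T, ∀ ω : Traj X (t + 1), C t (ω.upTo t) ≤ C (t + 1) ω) {t : ℕ} (ht : t < T)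
    (hNA : NoStrictArbitrageAt (priors T R₀ R) K C (tildeCone T R K C) (t + 1))
    {x : Traj X t → Pos d} (hx : UnivMeasurable x) (hxM : ∀ ω, x ω ∈ carryCone T R K C t ω)
    {k : (s : ℕ) → Traj X s → Pos d} (hk : ∀ s < t + 1, UnivMeasurable (k s) ∧
      QuasiSurely (priors T R₀ R) fun ω => k s (ω.upTo s) ∈ K s (ω.upTo s))
    (hbal : QuasiSurely (priors T R₀ R) fun ω =>
      -(x (ω.upTo t) + ∑ s ∈ Finset.range (t + 1), k s (ω.upTo s)) ∈
        tildeCone T R K C (t + 1) (ω.upTo (t + 1))) :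
    QuasiSurely (priors T R₀ R) fun ω => x (ω.upTo t) = 0 := by
  have hup : ∀ ω : Traj X T, (ω.upTo (t + 1)).upTo t = ω.upTo t :=
    fun ω => Traj.upTo_upTo (Nat.le_succ t) ω
  have h := hNA (fun ω => x (ω.upTo t)) k (hx.comp_measurable (Traj.measurable_upTo _ _)) hk
    (fun P _ => .of_forall fun ω => hC_mono t ht _ (hxM _).1)
    (by simpa only [hup] using hM.quasiSurely_mem_tildeCone (R₀ := R₀) ht hx hxM)
    (by simpa only [hup] using hbal)
  simpa only [hup] using h

end MeasurableModel

end Model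

/-! ### From no arbitrage at `t + 1` to no arbitrage at `t`. -/

section Model

variable {X : Type*} [MeasurableSpace X]
  {d T : ℕ} {R₀ : Set (ProbabilityMeasure X)}
  {R : (t : ℕ) → Traj X t → Set (ProbabilityMeasure X)} {K C : ConeFamily X d}

/-- Two universally measurable random cones `M`, `L` satisfy `M ∩ -L = {0}` quasi-surely as soon
as this holds for the universally measurable selectors. -/
theorem quasiSurely_forall_mem_eq_zero {Pr : Set (ProbabilityMeasure (Traj X T))} {t : ℕ}
    {M L : Traj X t → ProperCone ℝ (Pos d)}
    (hM : UnivMeasurableMultifunction fun ω => (M ω : Set (Pos d)))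
    (hL : UnivMeasurableMultifunction fun ω => (L ω : Set (Pos d)))
    (h : ∀ x : Traj X t → Pos d, UnivMeasurable x → (∀ ω, x ω ∈ M ω) → (∀ ω, -x ω ∈ L ω) →
      QuasiSurely Pr fun ω => x (ω.upTo t) = 0) :
    QuasiSurely Pr fun ω => ∀ x ∈ M (ω.upTo t), -x ∈ L (ω.upTo t) → x = 0 := by
  -- Unit vectors violating the claim. A selection, with default `0`, is nonzero wherever a
  -- violation exists.
  let F : Traj X t → Set (Pos d) := fun ω =>
    ((M ω : Set (Pos d)) ∩ {b | 0 - b ∈ (L ω : Set (Pos d))}) ∩ Metric.sphere 0 1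
  have hLc : ∀ ω, IsClosed {b : Pos d | 0 - b ∈ (L ω : Set (Pos d))} := fun ω =>
    (L ω).isClosed.preimage (continuous_const.sub continuous_id)
  have hF : UnivMeasurableMultifunction F := by
    have h1 := @MeasurableMultifunction.const_sub _ (universalCompletion _) _ _ _ _ _ _ _ hL
      (fun ω => (L ω).isClosed) (fun _ => 0) (univMeasurable_const 0)
    have h2 := @MeasurableMultifunction.inter _ (universalCompletion _) _ _ _ _ _ hM h1
      (fun ω => (M ω).isClosed) hLc
    exact @MeasurableMultifunction.inter _ (universalCompletion _) _ _ _ _ _ h2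
      (@MeasurableMultifunction.const _ (universalCompletion _) _ _ _)
      (fun ω => (M ω).isClosed.inter (hLc ω)) (fun _ => Metric.isClosed_sphere)
  obtain ⟨x, hx, hxF, hx0⟩ := exists_univMeasurable_selection hF
    fun ω => ((M ω).isClosed.inter (hLc ω)).inter Metric.isClosed_sphere
  have hmem : ∀ ω, x ω ∈ M ω ∧ -x ω ∈ L ω := by
    intro ω
    rcases (F ω).eq_empty_or_nonempty with he | hne
    · rw [hx0 ω he, neg_zero]
      exact ⟨zero_mem _, zero_mem _⟩
    · have := (hxF ω hne).1
      exact ⟨this.1, by simpa using this.2⟩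
  intro P hP
  filter_upwards [h x hx (fun ω => (hmem ω).1) (fun ω => (hmem ω).2) P hP] with ω hω y hyM hyL
  by_contra hy
  have hpos : 0 < ‖y‖ := norm_pos_iff.2 hy
  have h1 : ‖y‖⁻¹ • y ∈ F (ω.upTo t) := by
    refine ⟨⟨ProperCone.smul_mem _ hyM (by positivity), ?_⟩, ?_⟩
    · change 0 - ‖y‖⁻¹ • y ∈ L _
      rw [zero_sub, ← smul_neg]
      exact ProperCone.smul_mem _ hyL (by positivity)
    · simp [norm_smul, hpos.ne']
  have h2 := (hxF _ ⟨_, h1⟩).2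
  rw [hω] at h2
  simp at h2

theorem tildeCone_last : tildeCone T R K C T = K T := by
  funext ω
  rw [tildeCone, tildeDual_last, ProperCone.innerDual_innerDual]

variable [TopologicalSpace X] [PolishSpace X] [BorelSpace X]

namespace MeasurableModel

/-- No arbitrage at `t + 1` supplies the hypotheses of `dual_recursion` quasi-surely; the splitting
it yields is then selected measurably. -/
theorem oneStepDecomposition (hM : MeasurableModel T R K C)
    (hC_mono : ∀ t < T, ∀ ω : Traj X (t + 1), C t (ω.upTo t) ≤ C (t + 1) ω)
    {t : ℕ} (ht : t < T)
    (hEF : ∀ ω, (interior (ProperCone.innerDual (K t ω : Set (Pos d)) : Set (Pos d))).Nonempty)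
    (hNA : NoStrictArbitrageAt (priors T R₀ R) K C (tildeCone T R K C) (t + 1)) :
    OneStepDecomposition T R₀ R K C t := by
  have hcarry := hM.univMeasurableMultifunction_carryCone ht
  have hK := (hM.measurable_solvency t ht.le).univMeasurableMultifunction
  have hpointed : QuasiSurely (priors T R₀ R) fun ω =>
      ∀ x ∈ carryCone T R K C t (ω.upTo t), -x ∈ carryCone T R K C t (ω.upTo t) → x = 0 := by
    refine quasiSurely_forall_mem_eq_zero hcarry hcarry fun x hx hxM hxM' => ?_
    refine hM.quasiSurely_eq_zero_of_carryCone hC_mono ht hNA hx hxM (k := fun _ _ => 0)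
      (fun s _ => ⟨univMeasurable_const 0, fun P _ => .of_forall fun ω => zero_mem _⟩) ?_
    simpa using hM.quasiSurely_mem_tildeCone (R₀ := R₀) ht hx.neg hxM'
  have hcone : QuasiSurely (priors T R₀ R) fun ω =>
      ∀ x ∈ carryCone T R K C t (ω.upTo t), -x ∈ K t (ω.upTo t) → x = 0 := by
    refine quasiSurely_forall_mem_eq_zero hcarry hK fun x hx hxM hxK => ?_
    refine hM.quasiSurely_eq_zero_of_carryCone hC_mono ht hNA hx hxM
      -- The trade `-x ∈ K_t` at time `t` buys `x`, leaving a zero balance at `t + 1`.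
      (k := Function.update (fun _ _ => 0) t fun ω => -x ω) (fun s _ => ?_)
      fun P _ => .of_forall fun ω => ?_
    · rcases eq_or_ne s t with rfl | hs
      · rw [Function.update_self]
        exact ⟨hx.neg, fun P _ => .of_forall fun ω => hxK _⟩
      · rw [Function.update_of_ne hs]
        exact ⟨univMeasurable_const 0, fun P _ => .of_forall fun ω => zero_mem _⟩
    · rw [Finset.sum_range_succ, Function.update_self, Finset.sum_eq_zero fun s hs => by
        rw [Function.update_of_ne (Finset.mem_range.1 hs).ne]]
      simp
  have key : ∀ ω : Traj X t,
      (∀ x ∈ carryCone T R K C t ω, -x ∈ carryCone T R K C t ω → x = 0) →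
      (∀ x ∈ carryCone T R K C t ω, -x ∈ K t ω → x = 0) →
      (interior (tildeDual T R K C t ω)).Nonempty ∧
        ∀ x ∈ tildeCone T R K C t ω, ∃ b ∈ carryCone T R K C t ω, x - b ∈ K t ω := by
    intro ω h1 h2
    rw [tildeCone, tildeDual_of_lt ht]
    exact dual_recursion (K t ω) (C t ω) (G := dualSupport T R K C t ω)
      (zero_mem_dualSupport hM.nonempty ht ω) (fun c hc => smul_mem_dualSupport hc ht ω)
      (ProperCone.eq_zero_of_interior_innerDual_nonempty _ (hEF ω)) h1
      fun x hx hx' => neg_eq_zero.1 (h2 _ hx' (by rwa [neg_neg]))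
  refine ⟨fun P hP => ?_, fun ξ hξ hξK => ?_, hpointed⟩
  · filter_upwards [hpointed P hP, hcone P hP] with ω h1 h2
    exact (key _ h1 h2).1
  · have hKc : ∀ ω, IsClosed {b : Pos d | ξ ω - b ∈ (K t ω : Set (Pos d))} := fun ω =>
      (K t ω).isClosed.preimage (continuous_const.sub continuous_id)
    have hF := @MeasurableMultifunction.inter _ (universalCompletion _) _ _ _ _ _ hcarry
      (@MeasurableMultifunction.const_sub _ (universalCompletion _) _ _ _ _ _ _ _ hK
        (fun ω => (K t ω).isClosed) ξ hξ) (fun ω => ProperCone.isClosed _) hKc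
    obtain ⟨b, hb, hbF, hb0⟩ := exists_univMeasurable_selection hF
      fun ω => (ProperCone.isClosed _).inter (hKc ω)
    refine ⟨b, hb, fun ω => ?_, fun P hP => ?_⟩
    · rcases ((carryCone T R K C t ω : Set (Pos d)) ∩
        {b | ξ ω - b ∈ (K t ω : Set (Pos d))}).eq_empty_or_nonempty with he | hne
      · rw [hb0 ω he]
        exact zero_mem _
      · exact (hbF ω hne).1
    · filter_upwards [hpointed P hP, hcone P hP, hξK P hP] with ω h1 h2 h3
      obtain ⟨c, hc, hcK⟩ := (key _ h1 h2).2 _ h3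
      exact (hbF _ ⟨c, hc, hcK⟩).2

theorem noStrictArbitrageAt_of_succ (hM : MeasurableModel T R K C)
    (hC_mono : ∀ t < T, ∀ ω : Traj X (t + 1), C t (ω.upTo t) ≤ C (t + 1) ω)
    {t : ℕ} (ht : t < T) (hdec : OneStepDecomposition T R₀ R K C t)
    (hNAK : NoStrictArbitrageAt (priors T R₀ R) K C K t)
    (hNA : NoStrictArbitrageAt (priors T R₀ R) K C (tildeCone T R K C) (t + 1)) :
    NoStrictArbitrageAt (priors T R₀ R) K C (tildeCone T R K C) t := by
  intro ξ k hξ hk hξC hξK hbal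
  let kt : Traj X t → Pos d := fun ω => -(ξ ω + ∑ s ∈ Finset.range t, k s (ω.upTo s))
  have hkt : ∀ ω : Traj X T, kt (ω.upTo t) =
      -(ξ (ω.upTo t) + ∑ s ∈ Finset.range t, k s (ω.upTo s)) := by
    intro ω
    simp only [kt]
    rw [Finset.sum_congr rfl fun s hs => by rw [Traj.upTo_upTo (Finset.mem_range.1 hs).le]]
  have hktm : UnivMeasurable kt := univMeasurable_balance hξ fun s hs => (hk s hs).1
  obtain ⟨b, hb, hbM, hbK⟩ := hdec.decomposition kt hktm (by simpa only [hkt] using hbal)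
  obtain ⟨b', hb', hbM', hbK'⟩ := hdec.decomposition ξ hξ hξK
  -- The sum of the two carried parts is financed by the `K_t`-parts and the earlier trades; the
  -- carried parts cancel, so the closing trade at `t + 1` is `0`.
  have hsum := hM.quasiSurely_eq_zero_of_carryCone hC_mono ht hNA (hb.add hb')
    (fun ω => add_mem (hbM ω) (hbM' ω))
    (k := Function.update k t fun ω => (kt ω - b ω) + (ξ ω - b' ω)) (fun s hs => ?_)
    fun P _ => .of_forall fun ω => ?_
  · refine hNAK ξ k hξ hk hξC (fun P hP => ?_) (fun P hP => ?_)
    · filter_upwards [hsum P hP, hbK' P hP, hdec.pointed P hP] with ω h1 h2 h3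
      have h4 : b' (ω.upTo t) = 0 := h3 _ (hbM' _) (by
        rw [neg_eq_of_add_eq_zero_left h1]
        exact hbM _)
      rwa [h4, sub_zero] at h2
    · filter_upwards [hsum P hP, hbK P hP, hdec.pointed P hP] with ω h1 h2 h3
      have h4 : b (ω.upTo t) = 0 := h3 _ (hbM _) (by
        rw [neg_eq_of_add_eq_zero_right h1]
        exact hbM' _)
      rwa [h4, sub_zero, hkt] at h2
  · rcases (Nat.lt_succ_iff.1 hs).eq_or_lt with rfl | hs
    · rw [Function.update_self]
      refine ⟨(hktm.sub hb).add (hξ.sub hb'), fun P hP => ?_⟩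
      filter_upwards [hbK P hP, hbK' P hP] with ω h1 h2
      exact add_mem h1 h2
    · rw [Function.update_of_ne hs.ne]
      exact hk s hs
  · rw [Finset.sum_range_succ, Function.update_self, hkt, Finset.sum_congr rfl fun s hs => by
      rw [Function.update_of_ne (Finset.mem_range.1 hs).ne]]
    convert! zero_mem (tildeCone T R K C (t + 1) (ω.upTo (t + 1)))
    abel

theorem noStrictArbitrageAt_tildeCone (hM : MeasurableModel T R K C)
    (hC_mono : ∀ t < T, ∀ ω : Traj X (t + 1), C t (ω.upTo t) ≤ C (t + 1) ω)
    (hEF : ∀ t ≤ T, ∀ ω,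
      (interior (ProperCone.innerDual (K t ω : Set (Pos d)) : Set (Pos d))).Nonempty)
    (hNA : NoStrictArbitrage (priors T R₀ R) K C) {t : ℕ} (ht : t ≤ T) :
    NoStrictArbitrageAt (priors T R₀ R) K C (tildeCone T R K C) t := by
  have hNAK : ∀ t ≤ T, NoStrictArbitrageAt (priors T R₀ R) K C K t := fun t ht =>
    hNA.noStrictArbitrageAt ht (hM.measurable_solvency t ht) (hM.measurable_constraint t ht)
  refine Nat.decreasingInduction (motive := fun t _ =>
    NoStrictArbitrageAt (priors T R₀ R) K C (tildeCone T R K C) t) ?_ ?_ ht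
  · intro t ht ih
    exact hM.noStrictArbitrageAt_of_succ hC_mono ht
      (hM.oneStepDecomposition hC_mono ht (hEF t ht.le) ih) (hNAK t ht.le) ih
  · have h := hNAK T le_rfl
    unfold NoStrictArbitrageAt at h ⊢
    simpa only [tildeCone_last] using h

/-- Trades in the cones `K̃` can be replaced by trades in the cones `K` before time `n` and a trade
in `K̃_n`. -/
theorem exists_solvent_trades (hM : MeasurableModel T R K C)
    (hdec : ∀ t < T, OneStepDecomposition T R₀ R K C t) {k : (s : ℕ) → Traj X s → Pos d} {n : ℕ}
    (hn : n ≤ T)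
    (hk : ∀ s ≤ n, UnivMeasurable (k s) ∧
      QuasiSurely (priors T R₀ R) fun ω => k s (ω.upTo s) ∈ tildeCone T R K C s (ω.upTo s)) :
    ∃ (a : (s : ℕ) → Traj X s → Pos d) (c : Traj X n → Pos d),
      (∀ s < n, UnivMeasurable (a s) ∧
        QuasiSurely (priors T R₀ R) fun ω => a s (ω.upTo s) ∈ K s (ω.upTo s)) ∧
      UnivMeasurable c ∧
      (QuasiSurely (priors T R₀ R) fun ω => c (ω.upTo n) ∈ tildeCone T R K C n (ω.upTo n)) ∧
      ∀ ω : Traj X T, ∑ s ∈ Finset.range (n + 1), k s (ω.upTo s) =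
        ∑ s ∈ Finset.range n, a s (ω.upTo s) + c (ω.upTo n) := by
  induction n with
  | zero => exact ⟨fun _ _ => 0, k 0, by simp, (hk 0 le_rfl).1, (hk 0 le_rfl).2, by simp⟩
  | succ n ih =>
    obtain ⟨a, c, ha, hc, hcK, hsum⟩ := ih (by omega) fun s hs => hk s (by omega)
    obtain ⟨b, hb, hbM, hbK⟩ := (hdec n (by omega)).decomposition c hc hcK
    have hup : ∀ ω : Traj X T, (ω.upTo (n + 1)).upTo n = ω.upTo n :=
      fun ω => Traj.upTo_upTo (Nat.le_succ n) ω
    -- The `K_n`-part of `c` stays at time `n`; the carried part `b`, solvent for `K̃_{n+1}`, joins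
    -- the next trade.
    refine ⟨Function.update a n fun ω => c ω - b ω, fun ω => k (n + 1) ω + b (ω.upTo n),
      fun s hs => ?_, (hk _ le_rfl).1.add (hb.comp_measurable (Traj.measurable_upTo _ _)),
      fun P hP => ?_, fun ω => ?_⟩
    · rcases (Nat.lt_succ_iff.1 hs).eq_or_lt with rfl | hs
      · rw [Function.update_self]
        exact ⟨hc.sub hb, hbK⟩
      · rw [Function.update_of_ne hs.ne]
        exact ha s hs
    · filter_upwards [(hk _ le_rfl).2 P hP,
        hM.quasiSurely_mem_tildeCone (R₀ := R₀) (by omega) hb hbM P hP] with ω h1 h2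
      rw [hup]
      exact add_mem h1 h2
    · have hold : ∀ s ∈ Finset.range n,
          Function.update a n (fun ω => c ω - b ω) s (ω.upTo s) = a s (ω.upTo s) := fun s hs => by
        rw [Function.update_of_ne (Finset.mem_range.1 hs).ne]
      beta_reduce
      rw [Finset.sum_range_succ, hsum, Finset.sum_range_succ _ n, Function.update_self, hup,
        Finset.sum_congr rfl hold]
      abel

end MeasurableModel

end Model

/-! ### The proposition. -/

theorem mainTheorem3 {X : Type*} [TopologicalSpace X] [PolishSpace X] [MeasurableSpace X]
    [BorelSpace X] (d T : ℕ) (hd : 2 ≤ d)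
    (R₀ : Set (ProbabilityMeasure X))
    (R : (t : ℕ) → Traj X t → Set (ProbabilityMeasure X))
    (hR_ne : ∀ t < T, ∀ ω, (R t ω).Nonempty)
    (hR_an : ∀ t < T, AnalyticSet {p : Traj X t × ProbabilityMeasure X | p.2 ∈ R t p.1})
    (K C : ConeFamily X d)
    (hK_pos : ∀ t ≤ T, ∀ ω, ∀ x : Pos d, (∀ i, 0 ≤ x i) → x ∈ K t ω)
    (hK_meas : ∀ t ≤ T, MeasurableMultifunction fun ω => (K t ω : Set (Pos d)))
    (hC_meas : ∀ t ≤ T, MeasurableMultifunction fun ω => (C t ω : Set (Pos d)))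
    (hEF : ∀ t ≤ T, ∀ ω,
      (interior (ProperCone.innerDual (K t ω : Set (Pos d)) : Set (Pos d))).Nonempty)
    (hC_mono : ∀ t < T, ∀ ω : Traj X (t + 1), C t (ω.upTo t) ≤ C (t + 1) ω)
    (hNA : NoStrictArbitrage (priors T R₀ R) K C) :
    (∀ t ≤ T, QuasiSurely (priors T R₀ R) fun ω =>
      (interior (tildeDual T R K C t (ω.upTo t))).Nonempty) ∧
    NoStrictArbitrage (priors T R₀ R) (tildeCone T R K C) C := by
  have hM : MeasurableModel T R K C := ⟨hR_ne, hR_an, hK_meas, hC_meas⟩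
  have hNAt : ∀ t ≤ T, NoStrictArbitrageAt (priors T R₀ R) K C (tildeCone T R K C) t :=
    fun t ht => hM.noStrictArbitrageAt_tildeCone hC_mono hEF hNA ht
  have hdec : ∀ t < T, OneStepDecomposition T R₀ R K C t := fun t ht =>
    hM.oneStepDecomposition hC_mono ht (hEF t ht.le) (hNAt (t + 1) ht)
  refine ⟨fun t ht => ?_, fun t ht ξ => ?_⟩
  · rcases ht.eq_or_lt with rfl | ht
    · exact fun P _ => .of_forall fun ω => by
        rw [tildeDual_last]
        exact hEF t le_rfl _
    · exact (hdec t ht).interior_nonempty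
  · rintro ⟨hξ, hξC, k, hk, hsum⟩ hξK
    -- All trades before `t` now lie in `K`, and `c` is the closing trade in `K̃_t`: exactly the
    -- mixed condition at `t`.
    obtain ⟨a, c, ha, -, hcK, hac⟩ := hM.exists_solvent_trades hdec ht hk
    refine hNAt t ht ξ a hξ ha (fun P _ => .of_forall fun ω => hξC _)
      (fun P _ => .of_forall fun ω => hξK _) fun P hP => ?_
    filter_upwards [hsum P hP, hcK P hP] with ω h1 h2
    convert! h2 using 1
    rw [h1, Finset.sum_neg_distrib, hac]
    abel
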